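/- Let $M$ be a smooth manifold of dimension $2n+1\ge 5$, equipped with a smooth $(1,1)$-tensor field $\varphi$, a smooth vector field $\xi$, a smooth $1$-form $\eta$ and a smooth Riemannian or pseudo-Riemannian metric $g$ (of any signature) such that, for signs $\varepsilon_0,\varepsilon_1\in\{1,-1\}$ and all $X,Y$, $$\varphi^2X=\varepsilon_1\bigl(X-\eta(X)\xi\bigr),\qquad \eta(\xi)=1,\qquad g(\varphi X,\varphi Y)=-\varepsilon_1\bigl(g(X,Y)-\varepsilon_0\,\eta(X)\eta(Y)\bigr),$$ i.e. $(\varphi,\xi,\eta,g)$ is an almost contact metric ($\varepsilon_1=-1$) or almost paracontact metric ($\varepsilon_1=1$) structure. Assume that the structure is normal, i.e. for all vector fields $X,Y$ $$\varphi^2[X,Y]+[\varphi X,\varphi Y]-\varphi[\varphi X,Y]-\varphi[X,\varphi Y]-2\varepsilon_1\,d\eta(X,Y)\,\xi=0,\qquad 2\,d\eta(X,Y)=X(\eta(Y))-Y(\eta(X))-\eta([X,Y]),$$ and that $g$ is conformally flat, i.e. every point has an open neighbourhood $U$ with a smooth function $f:U\to\mathbb R$ such that the metric $e^{2f}g$ on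 $U$ has zero curvature. Let $R(X,Y)=[\nabla_X,\nabla_Y]-\nabla_{[X,Y]}$ be the curvature operator of the Levi-Civita connection $\nabla$ of $g$, $\mathrm{Ric}(Y,Z)=\mathrm{tr}\{X\mapsto R(X,Y)Z\}$ the Ricci tensor and $\widehat{\mathrm{Ric}}$ the Ricci operator, $g(\widehat{\mathrm{Ric}}\,X,Y)=\mathrm{Ric}(X,Y)$. Then at every point, for all tangent vectors $X,Y$, $$\widehat{\mathrm{Ric}}\,\varphi X-\varphi\,\widehat{\mathrm{Ric}}\,X=\eta(\widehat{\mathrm{Ric}}\,\varphi X)\,\xi-\eta(X)\,\varphi\,\widehat{\mathrm{Ric}}\,\xi,$$ $$\mathrm{Ric}(X,Y)+\varepsilon_1\mathrm{Ric}(\varphi X,\varphi Y)=\eta(X)\mathrm{Ric}(Y,\xi)+\eta(Y)\mathrm{Ric}(X,\xi)-\eta(X)\eta(Y)\mathrm{Ric}(\xi,\xi),$$ and $$\mathrm{Ric}(X,X)+\varepsilon_1\mathrm{Ric}(\varphi X,\varphi X)=0\qquad\text{for every }X\in\mathrm{Ker}\,\eta .$$ -/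

import Mathlib

set_option maxSynthPendingDepth 3

open scoped Manifold ContDiff

noncomputable section

namespace ParaContact

/-! ### Levi-Civita connection and curvature in coordinates

`G` is a field of bilinear forms on the vector space `E`, regarded as the coordinate expression
of a (pseudo-)Riemannian metric. -/

section Coordinates

variable {E : Type*} [NormedAddCommGroup E] [NormedSpace ℝ E]

/-- Christoffel symbols of the first kind:
`christoffelLower G y u v w = (D_u G(v,w) + D_v G(u,w) - D_w G(u,v)) / 2` at `y`. -/
def christoffelLower (G : E → E →L[ℝ] E →L[ℝ] ℝ) (y : E) : E →L[ℝ] E →L[ℝ] E →L[ℝ] ℝ :=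
  let D : E →L[ℝ] E →L[ℝ] E →L[ℝ] ℝ := fderiv ℝ G y
  let T : (E →L[ℝ] E →L[ℝ] ℝ) →L[ℝ] (E →L[ℝ] E →L[ℝ] ℝ) :=
    (ContinuousLinearMap.flipₗᵢ ℝ E E ℝ).toContinuousLinearEquiv
  (1 / 2 : ℝ) • (D + D.flip - T.comp D.flip)

theorem christoffelLower_apply (G : E → E →L[ℝ] E →L[ℝ] ℝ) (y u v w : E) :
    christoffelLower G y u v w =
      (fderiv ℝ G y u v w + fderiv ℝ G y v u w - fderiv ℝ G y w u v) / 2 := by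
  simp [christoffelLower]
  ring

/-- Christoffel symbols `Γ_y(u,v)` of the Levi-Civita connection of `G`, determined by
`G_y(Γ_y(u,v), w) = christoffelLower G y u v w` for all `w`. Thus `∇_X Y = D_X Y + Γ(X,Y)`. -/
def christoffel (G : E → E →L[ℝ] E →L[ℝ] ℝ) (y : E) : E →L[ℝ] E →L[ℝ] E :=
  (ContinuousLinearMap.compL ℝ E (E →L[ℝ] ℝ) E (G y).inverse).comp (christoffelLower G y)

theorem christoffel_apply (G : E → E →L[ℝ] E →L[ℝ] ℝ) (y u v : E) :
    christoffel G y u v = (G y).inverse (christoffelLower G y u v) := rfl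

/-- The curvature operator `R(u,v)w = ∇_u ∇_v w - ∇_v ∇_u w - ∇_[u,v] w` of the Levi-Civita
connection of `G` at `y`, for (the constant extensions of) `u v w : E`. It is written as a linear
map in `u`, in order to take traces. -/
def curvatureCoord (G : E → E →L[ℝ] E →L[ℝ] ℝ) (y v w : E) : E →ₗ[ℝ] E where
  toFun u := fderiv ℝ (christoffel G) y u v w - fderiv ℝ (christoffel G) y v u w
    + christoffel G y u (christoffel G y v w) - christoffel G y v (christoffel G y u w)
  map_add' u u' := by
    simp only [map_add, add_apply]
    abel
  map_smul' c u := by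
    simp only [map_smul, smul_apply, RingHom.id_apply, smul_add, smul_sub]

/-- The Ricci tensor `Ric(v,w) = tr (u ↦ R(u,v)w)` of `G` at `y`. -/
def ricciCoord (G : E → E →L[ℝ] E →L[ℝ] ℝ) (y : E) : E →ₗ[ℝ] E →ₗ[ℝ] ℝ :=
  LinearMap.mk₂ ℝ (fun v w => LinearMap.trace ℝ E (curvatureCoord G y v w))
    (fun v v' w => by
      rw [← map_add]; congr 1; ext u
      simp only [curvatureCoord, map_add, add_apply, LinearMap.add_apply, LinearMap.coe_mk, AddHom.coe_mk]
      abel)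
    (fun c v w => by
      rw [← map_smul]; congr 1; ext u
      simp only [curvatureCoord, map_smul, smul_apply, LinearMap.smul_apply, LinearMap.coe_mk, AddHom.coe_mk,
        smul_add, smul_sub])
    (fun v w w' => by
      rw [← map_add]; congr 1; ext u
      simp only [curvatureCoord, map_add, LinearMap.add_apply, LinearMap.coe_mk, AddHom.coe_mk]
      abel)
    (fun c v w => by
      rw [← map_smul]; congr 1; ext u
      simp only [curvatureCoord, map_smul, LinearMap.smul_apply, LinearMap.coe_mk, AddHom.coe_mk,
        smul_add, smul_sub])

end Coordinates

/-! ### Curvature of a metric on a manifold -/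

section Manifold

variable {E : Type*} [NormedAddCommGroup E] [NormedSpace ℝ E]
  {M : Type*} [TopologicalSpace M] [ChartedSpace E M]

/-- Coordinate expression of the field `g` of bilinear forms in the preferred chart at `x`, i.e. the
pullback of `g` under the inverse of this chart. -/
def metricInChart (g : ∀ x : M, TangentSpace 𝓘(ℝ, E) x →L[ℝ] TangentSpace 𝓘(ℝ, E) x →L[ℝ] ℝ)
    (x : M) (y : E) : E →L[ℝ] E →L[ℝ] ℝ :=
  let D : E →L[ℝ] E := mfderiv 𝓘(ℝ, E) 𝓘(ℝ, E) (extChartAt 𝓘(ℝ, E) x).symm y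
  let B : E →L[ℝ] E →L[ℝ] ℝ := g ((extChartAt 𝓘(ℝ, E) x).symm y)
  B.bilinearComp D D

/-- The Riemann curvature operator `R(u,v)w` of `g` at `x` (linear in `u`), computed in the preferred
chart at `x`: it is through this chart that `TangentSpace 𝓘(ℝ, E) x` is identified with `E`. -/
def curvature (g : ∀ x : M, TangentSpace 𝓘(ℝ, E) x →L[ℝ] TangentSpace 𝓘(ℝ, E) x →L[ℝ] ℝ)
    (x : M) (v w : TangentSpace 𝓘(ℝ, E) x) :
    TangentSpace 𝓘(ℝ, E) x →ₗ[ℝ] TangentSpace 𝓘(ℝ, E) x :=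
  show E →ₗ[ℝ] E from curvatureCoord (metricInChart g x) (extChartAt 𝓘(ℝ, E) x x) v w

/-- The Ricci tensor `Ric(v,w) = tr (u ↦ R(u,v)w)` of `g` at `x`. -/
def ricci (g : ∀ x : M, TangentSpace 𝓘(ℝ, E) x →L[ℝ] TangentSpace 𝓘(ℝ, E) x →L[ℝ] ℝ)
    (x : M) : TangentSpace 𝓘(ℝ, E) x →ₗ[ℝ] TangentSpace 𝓘(ℝ, E) x →ₗ[ℝ] ℝ :=
  show E →ₗ[ℝ] E →ₗ[ℝ] ℝ from ricciCoord (metricInChart g x) (extChartAt 𝓘(ℝ, E) x x)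

/-- The Ricci operator: `g (Q v) w = Ric(v,w)` for all `w`. -/
def ricciOp [FiniteDimensional ℝ E]
    (g : ∀ x : M, TangentSpace 𝓘(ℝ, E) x →L[ℝ] TangentSpace 𝓘(ℝ, E) x →L[ℝ] ℝ)
    (x : M) (v : TangentSpace 𝓘(ℝ, E) x) : TangentSpace 𝓘(ℝ, E) x :=
  let B : E →L[ℝ] E →L[ℝ] ℝ := g x
  let r : E →ₗ[ℝ] ℝ := ricci g x v
  B.inverse (LinearMap.toContinuousLinearMap r)

/-- `g` is conformally flat: every point has an open neighbourhood `U` with a smooth function `f`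
on `U` such that the metric `e^{2f} g` on `U` is flat, i.e. has zero curvature. -/
def IsConformallyFlat
    (g : ∀ x : M, TangentSpace 𝓘(ℝ, E) x →L[ℝ] TangentSpace 𝓘(ℝ, E) x →L[ℝ] ℝ) : Prop :=
  ∀ p : M, ∃ U : Set M, IsOpen U ∧ p ∈ U ∧ ∃ f : M → ℝ, ContMDiffOn 𝓘(ℝ, E) 𝓘(ℝ, ℝ) ∞ f U ∧
    ∀ x ∈ U, ∀ u v w : TangentSpace 𝓘(ℝ, E) x,
      curvature (fun y => Real.exp (2 * f y) • g y) x v w u = 0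

end Manifold

/-! ### Almost (para)contact metric structures -/

/-- An almost (para)contact metric structure `(φ, ξ, η, g)` on `M`, with signs `ε₀`, `ε₁`. The case
`ε₁ = -1` is almost contact, `ε₁ = 1` almost paracontact. In the latter case `φ` is
skew-adjoint for `g`, so the `±1`-eigendistributions of `φ` are isotropic complements of
each other in `Ker η`; that they have equal dimension is therefore automatic. -/
structure AlmostParaContactMetric (E : Type*) [NormedAddCommGroup E] [NormedSpace ℝ E]
    (M : Type*) [TopologicalSpace M] [ChartedSpace E M] [IsManifold 𝓘(ℝ, E) ∞ M] where
  ε₀ : ℝ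
  ε₁ : ℝ
  φ : ∀ x : M, TangentSpace 𝓘(ℝ, E) x →L[ℝ] TangentSpace 𝓘(ℝ, E) x
  ξ : ∀ x : M, TangentSpace 𝓘(ℝ, E) x
  η : ∀ x : M, TangentSpace 𝓘(ℝ, E) x →L[ℝ] ℝ
  g : ∀ x : M, TangentSpace 𝓘(ℝ, E) x →L[ℝ] TangentSpace 𝓘(ℝ, E) x →L[ℝ] ℝ
  sign₀ : ε₀ = 1 ∨ ε₀ = -1
  sign₁ : ε₁ = 1 ∨ ε₁ = -1
  smooth_φ : ContMDiff 𝓘(ℝ, E) (𝓘(ℝ, E).prod 𝓘(ℝ, E →L[ℝ] E)) ∞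
    (fun x => Bundle.TotalSpace.mk' (E →L[ℝ] E)
      (E := fun x : M => TangentSpace 𝓘(ℝ, E) x →L[ℝ] TangentSpace 𝓘(ℝ, E) x) x (φ x))
  smooth_ξ : ContMDiff 𝓘(ℝ, E) (𝓘(ℝ, E).prod 𝓘(ℝ, E)) ∞
    (fun x => Bundle.TotalSpace.mk' E (E := fun x : M => TangentSpace 𝓘(ℝ, E) x) x (ξ x))
  smooth_η : ContMDiff 𝓘(ℝ, E) (𝓘(ℝ, E).prod 𝓘(ℝ, E →L[ℝ] ℝ)) ∞
    (fun x => Bundle.TotalSpace.mk' (E →L[ℝ] ℝ)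
      (E := fun x : M => TangentSpace 𝓘(ℝ, E) x →L[ℝ] ℝ) x (η x))
  smooth_g : ContMDiff 𝓘(ℝ, E) (𝓘(ℝ, E).prod 𝓘(ℝ, E →L[ℝ] E →L[ℝ] ℝ)) ∞
    (fun x => Bundle.TotalSpace.mk' (E →L[ℝ] E →L[ℝ] ℝ)
      (E := fun x : M => TangentSpace 𝓘(ℝ, E) x →L[ℝ] TangentSpace 𝓘(ℝ, E) x →L[ℝ] ℝ) x (g x))
  g_symm : ∀ x v w, g x v w = g x w v
  g_nondeg : ∀ x v, (∀ w, g x v w = 0) → v = 0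
  φ_sq : ∀ x v, φ x (φ x v) = ε₁ • (v - η x v • ξ x)
  η_ξ : ∀ x, η x (ξ x) = 1
  compat : ∀ x v w, g x (φ x v) (φ x w) = -ε₁ * (g x v w - ε₀ * (η x v * η x w))

namespace AlmostParaContactMetric

variable {E : Type*} [NormedAddCommGroup E] [NormedSpace ℝ E]
  {M : Type*} [TopologicalSpace M] [ChartedSpace E M] [IsManifold 𝓘(ℝ, E) ∞ M]

/-- The Nijenhuis tensor `N(X,Y) = φ²[X,Y] + [φX,φY] - φ[φX,Y] - φ[X,φY]` of `φ` on vector fields. -/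
def nijenhuis (S : AlmostParaContactMetric E M) (X Y : ∀ x : M, TangentSpace 𝓘(ℝ, E) x) (x : M) :
    TangentSpace 𝓘(ℝ, E) x :=
  S.φ x (S.φ x (VectorField.mlieBracket 𝓘(ℝ, E) X Y x))
    + VectorField.mlieBracket 𝓘(ℝ, E) (fun y => S.φ y (X y)) (fun y => S.φ y (Y y)) x
    - S.φ x (VectorField.mlieBracket 𝓘(ℝ, E) (fun y => S.φ y (X y)) Y x)
    - S.φ x (VectorField.mlieBracket 𝓘(ℝ, E) X (fun y => S.φ y (Y y)) x)

/-- The exterior derivative of `η` on vector fields, in the normalization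
`2 dη(X,Y) = X(η(Y)) - Y(η(X)) - η([X,Y])`. -/
def dη (S : AlmostParaContactMetric E M) (X Y : ∀ x : M, TangentSpace 𝓘(ℝ, E) x) (x : M) : ℝ :=
  let ηX : M → ℝ := fun y => S.η y (X y)
  let ηY : M → ℝ := fun y => S.η y (Y y)
  (1 / 2 : ℝ) * (mvfderiv 𝓘(ℝ, E) ηY x (X x) - mvfderiv 𝓘(ℝ, E) ηX x (Y x)
    - S.η x (VectorField.mlieBracket 𝓘(ℝ, E) X Y x))

/-- Normality: the tensor `N⁽¹⁾ = N - 2 ε₁ dη ⊗ ξ` vanishes identically, i.e. on all (local) smooth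
vector fields. -/
def IsNormal (S : AlmostParaContactMetric E M) : Prop :=
  ∀ (x : M) (X Y : ∀ x : M, TangentSpace 𝓘(ℝ, E) x),
    ContMDiffAt 𝓘(ℝ, E) (𝓘(ℝ, E).prod 𝓘(ℝ, E)) ∞
      (fun y => Bundle.TotalSpace.mk' E (E := fun x : M => TangentSpace 𝓘(ℝ, E) x) y (X y)) x →
    ContMDiffAt 𝓘(ℝ, E) (𝓘(ℝ, E).prod 𝓘(ℝ, E)) ∞
      (fun y => Bundle.TotalSpace.mk' E (E := fun x : M => TangentSpace 𝓘(ℝ, E) x) y (Y y)) x →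
    S.nijenhuis X Y x - (2 * S.ε₁ * S.dη X Y x) • S.ξ x = 0

end AlmostParaContactMetric

end ParaContact

end

noncomputable section

namespace ParaContact

open Set Filter Topology

section Coordinates

variable {E : Type*} [NormedAddCommGroup E] [NormedSpace ℝ E]

/-- The derivative of a field of bilinear maps evaluated on two vector fields. -/
theorem fderiv_clm_apply_apply {F₁ F₂ F₃ : Type*} [NormedAddCommGroup F₁] [NormedSpace ℝ F₁]
    [NormedAddCommGroup F₂] [NormedSpace ℝ F₂] [NormedAddCommGroup F₃] [NormedSpace ℝ F₃]
    {B : E → F₁ →L[ℝ] F₂ →L[ℝ] F₃} {a : E → F₁} {b : E → F₂} {y : E}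
    (hB : DifferentiableAt ℝ B y) (ha : DifferentiableAt ℝ a y) (hb : DifferentiableAt ℝ b y)
    (u : E) :
    fderiv ℝ (fun z => B z (a z) (b z)) y u =
      fderiv ℝ B y u (a y) (b y) + B y (fderiv ℝ a y u) (b y) + B y (a y) (fderiv ℝ b y u) := by
  rw [fderiv_clm_apply (hB.clm_apply ha) hb, fderiv_clm_apply hB ha]
  simp
  abel

theorem fderiv_clm_apply_field {F₁ F₂ : Type*} [NormedAddCommGroup F₁] [NormedSpace ℝ F₁]
    [NormedAddCommGroup F₂] [NormedSpace ℝ F₂]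
    {B : E → F₁ →L[ℝ] F₂} {a : E → F₁} {y : E}
    (hB : DifferentiableAt ℝ B y) (ha : DifferentiableAt ℝ a y) (u : E) :
    fderiv ℝ (fun z => B z (a z)) y u = fderiv ℝ B y u (a y) + B y (fderiv ℝ a y u) := by
  rw [fderiv_clm_apply hB ha]
  simp
  abel

theorem fderiv_congr_of_isOpen {F : Type*} [NormedAddCommGroup F] [NormedSpace ℝ F]
    {U : Set E} (hU : IsOpen U) {f h : E → F} (hfh : ∀ z ∈ U, f z = h z) {y : E} (hy : y ∈ U) :
    fderiv ℝ f y = fderiv ℝ h y :=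
  (Filter.eventuallyEq_of_mem (hU.mem_nhds hy) hfh).fderiv_eq

/-- `G` is a `C²` pseudo-Riemannian metric on the open set `U` of the vector space `E`. -/
structure IsMetricOn (G : E → E →L[ℝ] E →L[ℝ] ℝ) (U : Set E) : Prop where
  isOpen : IsOpen U
  contDiffOn : ContDiffOn ℝ 2 G U
  symm : ∀ y ∈ U, ∀ v w, G y v w = G y w v
  nondeg : ∀ y ∈ U, ∀ v, (∀ w, G y v w = 0) → v = 0

namespace IsMetricOn

variable {G : E → E →L[ℝ] E →L[ℝ] ℝ} {U : Set E} {y : E}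

theorem contDiffAt (hM : IsMetricOn G U) (hy : y ∈ U) : ContDiffAt ℝ 2 G y :=
  hM.contDiffOn.contDiffAt (hM.isOpen.mem_nhds hy)

theorem differentiableAt (hM : IsMetricOn G U) (hy : y ∈ U) : DifferentiableAt ℝ G y :=
  (hM.contDiffAt hy).differentiableAt (by norm_num)

theorem ext (hM : IsMetricOn G U) (hy : y ∈ U) {v v' : E} (h : ∀ w, G y v w = G y v' w) :
    v = v' :=
  sub_eq_zero.1 (hM.nondeg y hy _ fun w => by simp [h w])

theorem fderiv_symm (hM : IsMetricOn G U) (hy : y ∈ U) (u v w : E) :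
    fderiv ℝ G y u v w = fderiv ℝ G y u w v := by
  have h := congrArg (fun L => L u) (fderiv_congr_of_isOpen hM.isOpen
    (f := fun z => G z v w) (h := fun z => G z w v) (fun z hz => hM.symm z hz v w) hy)
  have h0 : ∀ c : E, DifferentiableAt ℝ (fun _ : E => c) y := fun c => differentiableAt_const c
  simpa [fderiv_clm_apply_apply (hM.differentiableAt hy) (h0 _) (h0 _)] using h

theorem isInvertible [FiniteDimensional ℝ E] (hM : IsMetricOn G U) (hy : y ∈ U) :
    (G y).IsInvertible := by
  have hinj : Function.Injective (G y).toLinearMap := by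
    rw [injective_iff_map_eq_zero]
    intro v hv
    refine hM.nondeg y hy v fun w => ?_
    have hv' : G y v = 0 := hv
    simp [hv']
  have hdim : Module.finrank ℝ E = Module.finrank ℝ (E →L[ℝ] ℝ) := by
    rw [← (LinearMap.toContinuousLinearMap (𝕜 := ℝ) (E := E) (F' := ℝ)).finrank_eq]
    exact (Subspace.dual_finrank_eq (K := ℝ) (V := E)).symm
  exact ⟨(LinearEquiv.ofInjectiveOfFinrankEq (G y).toLinearMap hinj hdim).toContinuousLinearEquiv,
    by ext; rfl⟩

theorem conformal (hM : IsMetricOn G U) {f : E → ℝ} (hf : ContDiffOn ℝ 2 f U) :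
    IsMetricOn (fun z => Real.exp (2 * f z) • G z) U where
  isOpen := hM.isOpen
  contDiffOn := (Real.contDiff_exp.comp_contDiffOn (contDiffOn_const.mul hf)).smul hM.contDiffOn
  symm y hy v w := by simp [hM.symm y hy v w]
  nondeg y hy v h := hM.nondeg y hy v fun w => by simpa using h w

variable [FiniteDimensional ℝ E]

theorem apply_inverse (hM : IsMetricOn G U) (hy : y ∈ U) (a : E →L[ℝ] ℝ) (w : E) :
    G y ((G y).inverse a) w = a w := by
  rw [(hM.isInvertible hy).self_apply_inverse]

theorem apply_christoffel (hM : IsMetricOn G U) (hy : y ∈ U) (u v w : E) :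
    G y (christoffel G y u v) w =
      (fderiv ℝ G y u v w + fderiv ℝ G y v u w - fderiv ℝ G y w u v) / 2 := by
  rw [christoffel_apply, hM.apply_inverse hy, christoffelLower_apply]

theorem christoffel_symm (hM : IsMetricOn G U) (hy : y ∈ U) (u v : E) :
    christoffel G y u v = christoffel G y v u :=
  hM.ext hy fun w => by
    rw [hM.apply_christoffel hy, hM.apply_christoffel hy, hM.fderiv_symm hy w u v]
    ring

/-- The Levi-Civita connection is metric. -/
theorem fderiv_apply (hM : IsMetricOn G U) (hy : y ∈ U) (u v w : E) :
    fderiv ℝ G y u v w = G y (christoffel G y u v) w + G y v (christoffel G y u w) := by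
  rw [hM.symm y hy v, hM.apply_christoffel hy, hM.apply_christoffel hy, hM.fderiv_symm hy w u v,
    hM.fderiv_symm hy v u w, hM.fderiv_symm hy u w v]
  ring

/-- A torsion-free metric connection is the Levi-Civita connection. -/
theorem eq_christoffel (hM : IsMetricOn G U) (hy : y ∈ U) {C : E → E → E}
    (hC : ∀ u v, C u v = C v u)
    (hG : ∀ u v w, fderiv ℝ G y u v w = G y (C u v) w + G y (C u w) v) (u v : E) :
    christoffel G y u v = C u v :=
  hM.ext hy fun w => by
    rw [hM.apply_christoffel hy, hG, hG, hG, hC v u, hC w v, hC w u]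
    ring

theorem contDiffAt_inverse (hM : IsMetricOn G U) (hy : y ∈ U) :
    ContDiffAt ℝ 2 (fun z => (G z).inverse) y :=
  ((hM.isInvertible hy).contDiffAt_map_inverse (n := 2)).comp y (hM.contDiffAt hy)

theorem contDiffAt_christoffel (hM : IsMetricOn G U) (hy : y ∈ U) :
    ContDiffAt ℝ 1 (christoffel G) y := by
  have hD : ContDiffAt ℝ 1 (fderiv ℝ G) y := (hM.contDiffAt hy).fderiv_right (by norm_num)
  have hDf : ContDiffAt ℝ 1 (fun z => (fderiv ℝ G z).flip) y :=
    (ContinuousLinearMap.flipₗᵢ ℝ E E (E →L[ℝ] ℝ)).contDiff.contDiffAt.comp y hD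
  have hlow : ContDiffAt ℝ 1 (christoffelLower G) y := by
    unfold christoffelLower
    exact ((hD.add hDf).sub (contDiffAt_const.clm_comp hDf)).const_smul (1 / 2 : ℝ)
  unfold christoffel
  exact ((ContinuousLinearMap.compL ℝ E (E →L[ℝ] ℝ) E).contDiff.contDiffAt.comp y
    ((hM.contDiffAt_inverse hy).of_le (by norm_num))).clm_comp hlow

theorem differentiableAt_christoffel (hM : IsMetricOn G U) (hy : y ∈ U) :
    DifferentiableAt ℝ (christoffel G) y :=
  (hM.contDiffAt_christoffel hy).differentiableAt (by norm_num)

/-- The gradient of a function. -/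
theorem exists_grad (hM : IsMetricOn G U) {f : E → ℝ} (hf : ContDiffOn ℝ 2 f U) :
    ∃ F : E → E, (∀ z ∈ U, ∀ v, G z (F z) v = fderiv ℝ f z v) ∧
      ∀ z ∈ U, DifferentiableAt ℝ F z := by
  refine ⟨fun z => (G z).inverse (fderiv ℝ f z), fun z hz v => hM.apply_inverse hz _ v,
    fun z hz => ?_⟩
  have hf' : ContDiffAt ℝ 2 f z := hf.contDiffAt (hM.isOpen.mem_nhds hz)
  exact ((hM.contDiffAt_inverse hz).differentiableAt (by norm_num)).clm_apply
    ((hf'.fderiv_right (m := 1) (by norm_num)).differentiableAt (by norm_num))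

theorem christoffel_conformal (hM : IsMetricOn G U) {f : E → ℝ} (hf : ContDiffOn ℝ 2 f U)
    {F : E → E} (hF : ∀ z ∈ U, ∀ v, G z (F z) v = fderiv ℝ f z v) (hy : y ∈ U) (u v : E) :
    christoffel (fun z => Real.exp (2 * f z) • G z) y u v =
      christoffel G y u v + fderiv ℝ f y u • v + fderiv ℝ f y v • u - G y u v • F y := by
  refine (hM.conformal hf).eq_christoffel hy (C := fun u v => christoffel G y u v +
    fderiv ℝ f y u • v + fderiv ℝ f y v • u - G y u v • F y) (fun u v => ?_) (fun u v w => ?_) u v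
  · rw [hM.christoffel_symm hy u v, hM.symm y hy u v]
    abel
  · have hf' : DifferentiableAt ℝ f y :=
      (hf.contDiffAt (hM.isOpen.mem_nhds hy)).differentiableAt (by norm_num)
    have h2 : HasFDerivAt (fun z => Real.exp (2 * f z))
        (Real.exp (2 * f y) • ((2 : ℝ) • fderiv ℝ f y)) y :=
      (hf'.hasFDerivAt.const_mul 2).exp
    have h3 := (h2.smul (hM.differentiableAt hy).hasFDerivAt).fderiv
    have h4 : fderiv ℝ (fun z => Real.exp (2 * f z) • G z) y u v w =
        Real.exp (2 * f y) * (fderiv ℝ G y u v w + 2 * fderiv ℝ f y u * G y v w) := by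
      have h5 := congrArg (fun L => L u v w) h3
      simp only [add_apply, smul_apply, ContinuousLinearMap.smulRight_apply, smul_eq_mul] at h5
      refine h5.trans ?_
      ring
    rw [h4, hM.fderiv_apply hy, hM.symm y hy v]
    simp only [map_add, map_sub, map_smul, add_apply, sub_apply, smul_apply, smul_eq_mul, hF y hy]
    rw [hM.symm y hy w v]
    ring

end IsMetricOn

end Coordinates

section Coordinates

variable {E : Type*} [NormedAddCommGroup E] [NormedSpace ℝ E]

theorem curvatureCoord_apply (G : E → E →L[ℝ] E →L[ℝ] ℝ) (y u v w : E) :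
    curvatureCoord G y v w u = fderiv ℝ (christoffel G) y u v w - fderiv ℝ (christoffel G) y v u w
    + christoffel G y u (christoffel G y v w) - christoffel G y v (christoffel G y u w) := rfl

/-- The change of curvature under a conformal change of the metric: the curvatures of `e^{2f} g`
and `g` differ by the Kulkarni-Nomizu product of `g` and a symmetric tensor `g(S·,·)`. -/
theorem IsMetricOn.curvature_conformal [FiniteDimensional ℝ E] {G : E → E →L[ℝ] E →L[ℝ] ℝ}
    {U : Set E} {y : E} (hM : IsMetricOn G U) {f : E → ℝ} (hf : ContDiffOn ℝ 2 f U) (hy : y ∈ U) :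
    ∃ S : E →ₗ[ℝ] E, (∀ v w, G y (S v) w = G y (S w) v) ∧ ∀ u v w,
      curvatureCoord (fun z => Real.exp (2 * f z) • G z) y v w u = curvatureCoord G y v w u +
        G y (S u) w • v - G y (S v) w • u - G y v w • S u + G y u w • S v := by
  obtain ⟨F, hF, hFd⟩ := hM.exists_grad hf
  have hf2 : ContDiffAt ℝ 2 f y := hf.contDiffAt (hM.isOpen.mem_nhds hy)
  have hdf : DifferentiableAt ℝ (fderiv ℝ f) y :=
    (hf2.fderiv_right (m := 1) (by norm_num)).differentiableAt (by norm_num)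
  have hGd := hM.differentiableAt hy
  have hΓd := hM.differentiableAt_christoffel hy
  have hM' := hM.conformal hf
  have hc : ∀ c : E, DifferentiableAt ℝ (fun _ : E => c) y := fun c => differentiableAt_const c
  have hsymm2 : ∀ u v, fderiv ℝ (fderiv ℝ f) y u v = fderiv ℝ (fderiv ℝ f) y v u :=
    fun u v => hf2.isSymmSndFDerivAt (by simp) u v
  -- the Hessian of `f`
  have hess : ∀ u v, G y (fderiv ℝ F y u + christoffel G y u (F y)) v =
      fderiv ℝ (fderiv ℝ f) y u v - fderiv ℝ f y (christoffel G y u v) := by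
    intro u v
    have h := congrArg (fun L => L u) (fderiv_congr_of_isOpen hM.isOpen
      (f := fun z => G z (F z) v) (h := fun z => fderiv ℝ f z v) (fun z hz => hF z hz v) hy)
    rw [fderiv_clm_apply_apply hGd (hFd y hy) (hc v), fderiv_clm_apply_field hdf (hc v)] at h
    simp only [fderiv_fun_const, Pi.zero_apply, zero_apply, map_zero, add_zero] at h
    rw [hM.fderiv_apply hy, hF y hy] at h
    simp only [map_add, add_apply]
    linarith
  -- the derivative of the Christoffel symbols
  have hDΓ : ∀ u v w, fderiv ℝ (christoffel fun z => Real.exp (2 * f z) • G z) y u v w =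
      fderiv ℝ (christoffel G) y u v w + fderiv ℝ (fderiv ℝ f) y u v • w +
        fderiv ℝ (fderiv ℝ f) y u w • v - fderiv ℝ G y u v w • F y - G y v w • fderiv ℝ F y u := by
    intro u v w
    have h1 : fderiv ℝ (christoffel fun z => Real.exp (2 * f z) • G z) y u v w =
        fderiv ℝ (fun z => christoffel (fun z => Real.exp (2 * f z) • G z) z v w) y u := by
      rw [fderiv_clm_apply_apply (hM'.differentiableAt_christoffel hy) (hc v) (hc w)]
      simp
    have h2 := fderiv_congr_of_isOpen hM.isOpen
      (fun z hz => hM.christoffel_conformal hf hF hz v w) hy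
    have k1 : HasFDerivAt (fun z => christoffel G z v w) _ y :=
      ((hΓd.clm_apply (hc v)).clm_apply (hc w)).hasFDerivAt
    have k2 : ∀ a b : E, HasFDerivAt (fun z => fderiv ℝ f z a • b) _ y := fun a b =>
      ((hdf.clm_apply (hc a)).hasFDerivAt).smul (hasFDerivAt_const b y)
    have k3 : HasFDerivAt (fun z => G z v w • F z) _ y :=
      (((hGd.clm_apply (hc v)).clm_apply (hc w)).hasFDerivAt).smul (hFd y hy).hasFDerivAt
    have k := (((k1.add (k2 v w)).add (k2 w v)).sub k3).fderiv
    have k' := congrArg (fun L => L u) k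
    rw [h1, h2]
    refine k'.trans ?_
    simp only [add_apply, sub_apply, smul_apply, ContinuousLinearMap.smulRight_apply,
      smul_zero, zero_add]
    rw [fderiv_clm_apply_apply hΓd (hc v) (hc w), fderiv_clm_apply_apply hGd (hc v) (hc w),
      fderiv_clm_apply_field hdf (hc v), fderiv_clm_apply_field hdf (hc w)]
    simp only [fderiv_fun_const, Pi.zero_apply, zero_apply, map_zero, add_zero]
    abel
  have hF' : ∀ v, G y v (F y) = fderiv ℝ f y v := fun v => by rw [hM.symm y hy, hF y hy]
  set N : ℝ := fderiv ℝ f y (F y) with hN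
  refine ⟨(fderiv ℝ F y).toLinearMap + ((christoffel G y).flip (F y)).toLinearMap -
    (fderiv ℝ f y).toLinearMap.smulRight (F y) + (N / 2) • LinearMap.id, ?_, ?_⟩
  · intro v w
    have h1 := hess v w
    have h2 := hess w v
    rw [hM.christoffel_symm hy v w, hsymm2] at h1
    simp only [map_add, add_apply] at h1 h2
    simp only [LinearMap.add_apply, LinearMap.sub_apply, LinearMap.smul_apply,
      LinearMap.smulRight_apply, ContinuousLinearMap.coe_coe, ContinuousLinearMap.flip_apply,
      LinearMap.id_apply, map_add, map_sub, map_smul, add_apply, sub_apply, smul_apply,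
      smul_eq_mul, hF y hy, hM.symm y hy w v]
    linear_combination h1 - h2
  · intro u v w
    have h1 := hess u w
    have h2 := hess v w
    simp only [map_add, add_apply] at h1 h2
    simp only [curvatureCoord_apply, hDΓ, hM.christoffel_conformal hf hF hy]
    simp only [LinearMap.add_apply, LinearMap.sub_apply, LinearMap.smul_apply,
      LinearMap.smulRight_apply, ContinuousLinearMap.coe_coe, ContinuousLinearMap.flip_apply,
      LinearMap.id_apply, map_add, map_sub, map_smul, add_apply, sub_apply, smul_apply,
      smul_eq_mul, hF y hy, hF', ← hN, hM.fderiv_apply hy]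
    rw [hsymm2 v u, hM.christoffel_symm hy v u, hM.symm y hy v u, hM.symm y hy v (christoffel G y u w),
      hM.symm y hy u (christoffel G y v w), show fderiv ℝ (fderiv ℝ f) y u w = G y (fderiv ℝ F y u) w +
        G y (christoffel G y u (F y)) w + fderiv ℝ f y (christoffel G y u w) by linarith,
      show fderiv ℝ (fderiv ℝ f) y v w = G y (fderiv ℝ F y v) w +
        G y (christoffel G y v (F y)) w + fderiv ℝ f y (christoffel G y v w) by linarith]
    module

/-- The Ricci tensor of a metric whose curvature is the Kulkarni-Nomizu product of the metric
and a symmetric tensor. -/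
theorem ricciCoord_eq_of_curvature [FiniteDimensional ℝ E] {G : E → E →L[ℝ] E →L[ℝ] ℝ} {y : E}
    {S : E →ₗ[ℝ] E} (hsymm : ∀ v w, G y v w = G y w v) (hS : ∀ v w, G y (S v) w = G y (S w) v)
    (hR : ∀ u v w, curvatureCoord G y v w u =
      G y (S v) w • u - G y (S u) w • v + G y v w • S u - G y u w • S v) (v w : E) :
    ricciCoord G y v w = ((Module.finrank ℝ E : ℝ) - 2) * G y (S v) w +
      LinearMap.trace ℝ E S * G y v w := by
  have h : curvatureCoord G y v w = G y (S v) w • LinearMap.id -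
      ((G y (S w)).toLinearMap).smulRight v + G y v w • S - ((G y w).toLinearMap).smulRight (S v) := by
    ext u
    simp [hR, hS w u, hsymm w u]
  change LinearMap.trace ℝ E (curvatureCoord G y v w) = _
  rw [h]
  simp only [map_sub, map_add, map_smul, LinearMap.trace_id, LinearMap.trace_smulRight,
    ContinuousLinearMap.coe_coe, smul_eq_mul]
  rw [hS w v, hsymm w]
  ring

end Coordinates

section Coordinates

variable {E : Type*} [NormedAddCommGroup E] [NormedSpace ℝ E]

/-- A normal almost (para)contact metric structure on an open set `U` of the vector space `E`;
normality is expressed on constant vector fields. -/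
structure IsNormalOn (ε₀ ε₁ : ℝ) (G : E → E →L[ℝ] E →L[ℝ] ℝ) (φ : E → E →L[ℝ] E) (ξ : E → E)
    (η : E → E →L[ℝ] ℝ) (U : Set E) : Prop extends IsMetricOn G U where
  sign₀ : ε₀ * ε₀ = 1
  sign₁ : ε₁ * ε₁ = 1
  contDiffOn_φ : ContDiffOn ℝ 2 φ U
  contDiffOn_ξ : ContDiffOn ℝ 2 ξ U
  contDiffOn_η : ContDiffOn ℝ 2 η U
  φ_sq : ∀ y ∈ U, ∀ v, φ y (φ y v) = ε₁ • (v - η y v • ξ y)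
  η_ξ : ∀ y ∈ U, η y (ξ y) = 1
  compat : ∀ y ∈ U, ∀ v w, G y (φ y v) (φ y w) = -ε₁ * (G y v w - ε₀ * (η y v * η y w))
  normal : ∀ y ∈ U, ∀ u v,
    fderiv ℝ φ y (φ y u) v - fderiv ℝ φ y (φ y v) u + φ y (fderiv ℝ φ y v u)
      - φ y (fderiv ℝ φ y u v) = (ε₁ * (fderiv ℝ η y u v - fderiv ℝ η y v u)) • ξ y

namespace IsNormalOn

variable {ε₀ ε₁ : ℝ} {G : E → E →L[ℝ] E →L[ℝ] ℝ} {φ : E → E →L[ℝ] E} {ξ : E → E}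
    {η : E → E →L[ℝ] ℝ} {U : Set E} {y : E}

theorem mono (h : IsNormalOn ε₀ ε₁ G φ ξ η U) {V : Set E} (hV : IsOpen V) (hVU : V ⊆ U) :
    IsNormalOn ε₀ ε₁ G φ ξ η V where
  isOpen := hV
  contDiffOn := h.contDiffOn.mono hVU
  symm y hy := h.symm y (hVU hy)
  nondeg y hy := h.nondeg y (hVU hy)
  sign₀ := h.sign₀
  sign₁ := h.sign₁
  contDiffOn_φ := h.contDiffOn_φ.mono hVU
  contDiffOn_ξ := h.contDiffOn_ξ.mono hVU
  contDiffOn_η := h.contDiffOn_η.mono hVU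
  φ_sq y hy := h.φ_sq y (hVU hy)
  η_ξ y hy := h.η_ξ y (hVU hy)
  compat y hy := h.compat y (hVU hy)
  normal y hy := h.normal y (hVU hy)

theorem differentiableAt_φ (h : IsNormalOn ε₀ ε₁ G φ ξ η U) (hy : y ∈ U) :
    DifferentiableAt ℝ φ y :=
  (h.contDiffOn_φ.contDiffAt (h.isOpen.mem_nhds hy)).differentiableAt (by norm_num)

theorem contDiffAt_ξ (h : IsNormalOn ε₀ ε₁ G φ ξ η U) (hy : y ∈ U) : ContDiffAt ℝ 2 ξ y :=
  h.contDiffOn_ξ.contDiffAt (h.isOpen.mem_nhds hy)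

theorem differentiableAt_ξ (h : IsNormalOn ε₀ ε₁ G φ ξ η U) (hy : y ∈ U) :
    DifferentiableAt ℝ ξ y :=
  (h.contDiffAt_ξ hy).differentiableAt (by norm_num)

theorem differentiableAt_η (h : IsNormalOn ε₀ ε₁ G φ ξ η U) (hy : y ∈ U) :
    DifferentiableAt ℝ η y :=
  (h.contDiffOn_η.contDiffAt (h.isOpen.mem_nhds hy)).differentiableAt (by norm_num)

theorem ne_zero₁ (h : IsNormalOn ε₀ ε₁ G φ ξ η U) : ε₁ ≠ 0 := fun h0 => by
  simpa [h0] using h.sign₁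

theorem ne_zero₀ (h : IsNormalOn ε₀ ε₁ G φ ξ η U) : ε₀ ≠ 0 := fun h0 => by
  simpa [h0] using h.sign₀

theorem eq_smul_ξ (h : IsNormalOn ε₀ ε₁ G φ ξ η U) (hy : y ∈ U) {w : E} (hw : φ y w = 0) :
    w = η y w • ξ y := by
  have h1 := h.φ_sq y hy w
  rw [hw, map_zero] at h1
  exact sub_eq_zero.1 ((smul_eq_zero.1 h1.symm).resolve_left h.ne_zero₁)

theorem φ_ξ (h : IsNormalOn ε₀ ε₁ G φ ξ η U) (hy : y ∈ U) : φ y (ξ y) = 0 := by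
  have h1 : φ y (φ y (ξ y)) = 0 := by simp [h.φ_sq y hy, h.η_ξ y hy]
  obtain ⟨c, hc⟩ : ∃ c : ℝ, φ y (ξ y) = c • ξ y := ⟨_, h.eq_smul_ξ hy h1⟩
  rw [hc, map_smul, hc, smul_smul, smul_eq_zero] at h1
  rcases h1 with h1 | h1
  · rw [hc, mul_self_eq_zero.1 h1, zero_smul]
  · rw [h1, map_zero]

theorem η_φ (h : IsNormalOn ε₀ ε₁ G φ ξ η U) (hy : y ∈ U) (v : E) : η y (φ y v) = 0 := by
  have h1 := h.φ_sq y hy (φ y v)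
  rw [h.φ_sq y hy v, map_smul, map_sub, map_smul, h.φ_ξ hy, smul_zero, sub_zero] at h1
  have h2 := congrArg (η y) (smul_right_injective E h.ne_zero₁ h1)
  simpa [h.η_ξ y hy] using h2

theorem G_ξ (h : IsNormalOn ε₀ ε₁ G φ ξ η U) (hy : y ∈ U) (v : E) :
    G y (ξ y) v = ε₀ * η y v := by
  have h1 := h.compat y hy (ξ y) v
  rw [h.φ_ξ hy, map_zero, zero_apply, h.η_ξ y hy, one_mul] at h1
  have h2 := (mul_eq_zero.1 h1.symm).resolve_left (neg_ne_zero.2 h.ne_zero₁)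
  linarith

theorem G_φ (h : IsNormalOn ε₀ ε₁ G φ ξ η U) (hy : y ∈ U) (v w : E) :
    G y (φ y v) w = -G y v (φ y w) := by
  have h1 := h.compat y hy v (φ y w)
  rw [h.φ_sq y hy, h.η_φ hy] at h1
  simp only [map_smul, map_sub, smul_eq_mul, h.symm y hy _ (ξ y), h.G_ξ hy, h.η_φ hy, mul_zero,
    sub_zero] at h1
  have := h.ne_zero₁
  have h2 : ε₁ * (G y (φ y v) w + G y v (φ y w)) = 0 := by linarith
  have h3 := (mul_eq_zero.1 h2).resolve_left this
  linarith

/-! First derivatives of the algebraic identities. -/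

theorem φ_fderiv_ξ (h : IsNormalOn ε₀ ε₁ G φ ξ η U) (hy : y ∈ U) (u : E) :
    fderiv ℝ φ y u (ξ y) = -φ y (fderiv ℝ ξ y u) := by
  have h1 := congrArg (fun L => L u) (fderiv_congr_of_isOpen h.isOpen
    (f := fun z => φ z (ξ z)) (h := fun _ => 0) (fun z hz => h.φ_ξ hz) hy)
  rw [fderiv_clm_apply_field (h.differentiableAt_φ hy) (h.differentiableAt_ξ hy)] at h1
  exact eq_neg_of_add_eq_zero_left (by simpa using h1)

theorem η_fderiv_φ (h : IsNormalOn ε₀ ε₁ G φ ξ η U) (hy : y ∈ U) (u v : E) :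
    η y (fderiv ℝ φ y u v) = -fderiv ℝ η y u (φ y v) := by
  have h1 := congrArg (fun L => L u) (fderiv_congr_of_isOpen h.isOpen
    (f := fun z => η z (φ z v)) (h := fun _ => 0) (fun z hz => h.η_φ hz v) hy)
  have hc := differentiableAt_const (𝕜 := ℝ) (x := y) v
  rw [fderiv_clm_apply_field (h.differentiableAt_η hy)
    ((h.differentiableAt_φ hy).clm_apply hc),
    fderiv_clm_apply_field (h.differentiableAt_φ hy) hc] at h1
  exact eq_neg_of_add_eq_zero_right (by simpa using h1)

theorem η_fderiv_ξ (h : IsNormalOn ε₀ ε₁ G φ ξ η U) (hy : y ∈ U) (u : E) :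
    η y (fderiv ℝ ξ y u) = -fderiv ℝ η y u (ξ y) := by
  have h1 := congrArg (fun L => L u) (fderiv_congr_of_isOpen h.isOpen
    (f := fun z => η z (ξ z)) (h := fun _ => 1) (fun z hz => h.η_ξ z hz) hy)
  rw [fderiv_clm_apply_field (h.differentiableAt_η hy) (h.differentiableAt_ξ hy)] at h1
  exact eq_neg_of_add_eq_zero_right (by simpa using h1)

/-! Consequences of normality: `ξ ⌟ dη = 0`, `L_ξ φ = 0`, and `dη` is `φ`-invariant. -/

theorem dη_ξ (h : IsNormalOn ε₀ ε₁ G φ ξ η U) (hy : y ∈ U) (u : E) :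
    fderiv ℝ η y u (ξ y) = fderiv ℝ η y (ξ y) u := by
  have h1 := congrArg (η y) (h.normal y hy u (ξ y))
  rw [h.φ_ξ hy, map_zero, zero_apply, h.φ_fderiv_ξ hy] at h1
  simp only [map_add, map_sub, map_neg, map_zero, map_smul, h.η_φ hy, h.η_ξ y hy, smul_eq_mul,
    mul_one] at h1
  have h2 := (mul_eq_zero.1 (show ε₁ * (fderiv ℝ η y u (ξ y) - fderiv ℝ η y (ξ y) u) = 0 by
    linarith)).resolve_left h.ne_zero₁
  linarith

theorem lie_φ (h : IsNormalOn ε₀ ε₁ G φ ξ η U) (hy : y ∈ U) (u : E) :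
    fderiv ℝ φ y (ξ y) u = fderiv ℝ ξ y (φ y u) - φ y (fderiv ℝ ξ y u) := by
  have h1 := h.normal y hy u (ξ y)
  rw [h.φ_ξ hy, map_zero, zero_apply, h.φ_fderiv_ξ hy, h.φ_fderiv_ξ hy, h.dη_ξ hy, sub_self,
    mul_zero, zero_smul] at h1
  have h2 : φ y (fderiv ℝ φ y (ξ y) u - fderiv ℝ ξ y (φ y u) + φ y (fderiv ℝ ξ y u)) = 0 := by
    simp only [map_add, map_sub, map_neg] at h1 ⊢
    rw [← h1]
    abel
  have h3 := h.eq_smul_ξ hy h2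
  have h4 : η y (fderiv ℝ φ y (ξ y) u - fderiv ℝ ξ y (φ y u) + φ y (fderiv ℝ ξ y u)) = 0 := by
    simp only [map_add, map_sub, h.η_φ hy, h.η_fderiv_φ hy, h.η_fderiv_ξ hy, h.dη_ξ hy]
    ring
  rw [h4, zero_smul] at h3
  rw [← sub_eq_zero, ← h3]
  abel

theorem dη_φ_φ (h : IsNormalOn ε₀ ε₁ G φ ξ η U) (hy : y ∈ U) (u v : E) :
    fderiv ℝ η y (φ y u) (φ y v) - fderiv ℝ η y (φ y v) (φ y u) =
      -ε₁ * (fderiv ℝ η y u v - fderiv ℝ η y v u) := by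
  have h1 := congrArg (η y) (h.normal y hy u v)
  simp only [map_add, map_sub, map_smul, h.η_φ hy, h.η_ξ y hy, smul_eq_mul,
    mul_one, h.η_fderiv_φ hy] at h1
  linarith

theorem dη_φ (h : IsNormalOn ε₀ ε₁ G φ ξ η U) (hy : y ∈ U) (u v : E) :
    fderiv ℝ η y (φ y u) v - fderiv ℝ η y v (φ y u) =
      -(fderiv ℝ η y u (φ y v) - fderiv ℝ η y (φ y v) u) := by
  have h1 := h.dη_φ_φ hy (φ y u) v
  rw [h.φ_sq y hy] at h1
  simp only [map_smul, map_sub, smul_apply, sub_apply, smul_eq_mul, h.dη_ξ hy] at h1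
  have h2 := (mul_eq_zero.1 (show ε₁ * ((fderiv ℝ η y (φ y u) v - fderiv ℝ η y v (φ y u)) +
      (fderiv ℝ η y u (φ y v) - fderiv ℝ η y (φ y v) u)) = 0 by linarith)).resolve_left h.ne_zero₁
  linarith

end IsNormalOn

/-- The covariant derivative `u ↦ ∇_u ξ`. -/
def covDeriv (G : E → E →L[ℝ] E →L[ℝ] ℝ) (ξ : E → E) (y : E) : E →L[ℝ] E :=
  fderiv ℝ ξ y + (christoffel G y).flip (ξ y)

theorem covDeriv_apply (G : E → E →L[ℝ] E →L[ℝ] ℝ) (ξ : E → E) (y u : E) :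
    covDeriv G ξ y u = fderiv ℝ ξ y u + christoffel G y u (ξ y) := rfl

namespace IsNormalOn

variable {ε₀ ε₁ : ℝ} {G : E → E →L[ℝ] E →L[ℝ] ℝ} {φ : E → E →L[ℝ] E} {ξ : E → E}
    {η : E → E →L[ℝ] ℝ} {U : Set E} {y : E} [FiniteDimensional ℝ E]

theorem G_covDeriv (h : IsNormalOn ε₀ ε₁ G φ ξ η U) (hy : y ∈ U) (u v : E) :
    G y (covDeriv G ξ y u) v = ε₀ * (fderiv ℝ η y u v - η y (christoffel G y u v)) := by
  have h1 := congrArg (fun L => L u) (fderiv_congr_of_isOpen h.isOpen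
    (f := fun z => G z (ξ z) v) (h := fun z => ε₀ * η z v) (fun z hz => h.G_ξ hz v) hy)
  have hc := differentiableAt_const (𝕜 := ℝ) (x := y) v
  rw [fderiv_clm_apply_apply (h.differentiableAt hy) (h.differentiableAt_ξ hy) hc,
    fderiv_const_mul ((h.differentiableAt_η hy).clm_apply hc), smul_apply,
    fderiv_clm_apply_field (h.differentiableAt_η hy) hc, h.fderiv_apply hy, h.G_ξ hy] at h1
  simp only [fderiv_fun_const, Pi.zero_apply, zero_apply, map_zero, add_zero, smul_eq_mul] at h1
  rw [covDeriv_apply, map_add, add_apply]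
  linarith

theorem η_covDeriv (h : IsNormalOn ε₀ ε₁ G φ ξ η U) (hy : y ∈ U) (u : E) :
    η y (covDeriv G ξ y u) = 0 := by
  have h1 := h.G_covDeriv hy u (ξ y)
  rw [h.symm y hy, h.G_ξ hy] at h1
  have h2 := mul_left_cancel₀ h.ne_zero₀ h1
  have h3 := h.η_fderiv_ξ hy u
  rw [covDeriv_apply, map_add] at h2 ⊢
  linarith

/-- The integral curves of `ξ` are geodesics. -/
theorem covDeriv_ξ (h : IsNormalOn ε₀ ε₁ G φ ξ η U) (hy : y ∈ U) :
    covDeriv G ξ y (ξ y) = 0 := by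
  refine h.ext hy fun w => ?_
  have h1 := h.G_covDeriv hy w (ξ y)
  rw [h.symm y hy, h.G_ξ hy, h.η_covDeriv hy, h.dη_ξ hy, h.christoffel_symm hy] at h1
  rw [h.G_covDeriv hy, ← h1]
  simp

/-- `∇_ξ φ` is the commutator of `∇ξ` and `φ`. -/
theorem nabla_ξ_φ (h : IsNormalOn ε₀ ε₁ G φ ξ η U) (hy : y ∈ U) (u : E) :
    fderiv ℝ φ y (ξ y) u + christoffel G y (ξ y) (φ y u) - φ y (christoffel G y (ξ y) u) =
      covDeriv G ξ y (φ y u) - φ y (covDeriv G ξ y u) := by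
  rw [h.lie_φ hy, covDeriv_apply, covDeriv_apply, map_add, h.christoffel_symm hy (ξ y),
    h.christoffel_symm hy (ξ y)]
  abel

/-- `∇ξ` commutes with `φ`, since the commutator is both symmetric and skew for `G`. -/
theorem covDeriv_φ (h : IsNormalOn ε₀ ε₁ G φ ξ η U) (hy : y ∈ U) (u : E) :
    covDeriv G ξ y (φ y u) = φ y (covDeriv G ξ y u) := by
  set A := covDeriv G ξ y with hA
  have hsymm : ∀ u v, G y (A (φ y u) - φ y (A u)) v = G y (A (φ y v) - φ y (A v)) u := by
    intro u v
    simp only [map_sub, sub_apply, h.G_φ hy, hA, h.G_covDeriv hy]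
    have h1 := h.dη_φ hy u v
    rw [h.christoffel_symm hy v, h.christoffel_symm hy u]
    linear_combination ε₀ * h1
  have hskew : ∀ u v, G y (A (φ y u) - φ y (A u)) v = -G y (A (φ y v) - φ y (A v)) u := by
    intro u v
    rw [← h.nabla_ξ_φ hy, ← h.nabla_ξ_φ hy]
    have hc : ∀ c : E, DifferentiableAt ℝ (fun _ : E => c) y := fun c => differentiableAt_const c
    have hφ := h.differentiableAt_φ hy
    have h1 := congrArg (fun L => L (ξ y)) (fderiv_congr_of_isOpen h.isOpen
      (f := fun z => G z (φ z u) v) (h := fun z => -G z u (φ z v)) (fun z hz => h.G_φ hz u v) hy)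
    rw [fderiv_clm_apply_apply (h.differentiableAt hy) (hφ.clm_apply (hc u)) (hc v), fderiv_fun_neg,
      neg_apply, fderiv_clm_apply_apply (h.differentiableAt hy) (hc u) (hφ.clm_apply (hc v)),
      fderiv_clm_apply_field hφ (hc u), fderiv_clm_apply_field hφ (hc v)] at h1
    simp only [fderiv_fun_const, Pi.zero_apply, zero_apply, map_zero, add_zero,
      h.fderiv_apply hy, h.G_φ hy] at h1
    simp only [map_add, map_sub, add_apply, sub_apply, h.G_φ hy]
    rw [h.symm y hy _ u, h.symm y hy _ u, h.symm y hy _ (φ y u), h.G_φ hy]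
    linear_combination h1
  refine h.ext hy fun w => sub_eq_zero.1 ?_
  rw [← sub_apply, ← map_sub]
  linarith [hsymm u w, hskew u w]

theorem nabla_ξ_φ_eq_zero (h : IsNormalOn ε₀ ε₁ G φ ξ η U) (hy : y ∈ U) (u : E) :
    fderiv ℝ φ y (ξ y) u = φ y (christoffel G y (ξ y) u) - christoffel G y (ξ y) (φ y u) := by
  have h1 := h.nabla_ξ_φ hy u
  rw [h.covDeriv_φ hy, sub_self] at h1
  rw [← sub_eq_zero, ← h1]
  abel

theorem differentiableAt_covDeriv (h : IsNormalOn ε₀ ε₁ G φ ξ η U) (hy : y ∈ U) :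
    DifferentiableAt ℝ (covDeriv G ξ) y := by
  have h1 : DifferentiableAt ℝ (fderiv ℝ ξ) y :=
    ((h.contDiffAt_ξ hy).fderiv_right (m := 1) (by norm_num)).differentiableAt (by norm_num)
  have h2 : DifferentiableAt ℝ (fun z => (christoffel G z).flip) y :=
    (ContinuousLinearMap.flipₗᵢ ℝ E E E).differentiableAt.comp y (h.differentiableAt_christoffel hy)
  exact h1.add (h2.clm_apply (h.differentiableAt_ξ hy))

/-- The Jacobi operator of `ξ` is `-∇_ξ A - A²` for `A = ∇ξ`. -/
theorem curvature_ξ_ξ (h : IsNormalOn ε₀ ε₁ G φ ξ η U) (hy : y ∈ U) (u : E) :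
    curvatureCoord G y (ξ y) (ξ y) u =
      -(fderiv ℝ (covDeriv G ξ) y (ξ y) u + christoffel G y (ξ y) (covDeriv G ξ y u)
        - covDeriv G ξ y (christoffel G y (ξ y) u)) - covDeriv G ξ y (covDeriv G ξ y u) := by
  have hξ := h.differentiableAt_ξ hy
  have hΓ := h.differentiableAt_christoffel hy
  have hc : ∀ c : E, DifferentiableAt ℝ (fun _ : E => c) y := fun c => differentiableAt_const c
  have hdξ : DifferentiableAt ℝ (fderiv ℝ ξ) y :=
    ((h.contDiffAt_ξ hy).fderiv_right (m := 1) (by norm_num)).differentiableAt (by norm_num)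
  have hA : ∀ u v, fderiv ℝ (covDeriv G ξ) y u v = fderiv ℝ (fderiv ℝ ξ) y u v +
      fderiv ℝ (christoffel G) y u v (ξ y) + christoffel G y v (fderiv ℝ ξ y u) := by
    intro u v
    have h1 : fderiv ℝ (covDeriv G ξ) y u v = fderiv ℝ (fun z => covDeriv G ξ z v) y u := by
      rw [fderiv_clm_apply_field (h.differentiableAt_covDeriv hy) (hc v)]
      simp
    have h2 : (fun z => covDeriv G ξ z v) =
      fun z => fderiv ℝ ξ z v + christoffel G z v (ξ z) := rfl
    rw [h1, h2, fderiv_fun_add (hdξ.clm_apply (hc v)) ((hΓ.clm_apply (hc v)).clm_apply hξ),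
      add_apply, fderiv_clm_apply_field hdξ (hc v), fderiv_clm_apply_apply hΓ (hc v) hξ]
    simp only [fderiv_fun_const, Pi.zero_apply, zero_apply, map_zero, add_zero]
    abel
  have h1 := congrArg (fun L => L u) (fderiv_congr_of_isOpen h.isOpen
    (f := fun z => covDeriv G ξ z (ξ z)) (h := fun _ => 0) (fun z hz => h.covDeriv_ξ hz) hy)
  rw [fderiv_clm_apply_field (h.differentiableAt_covDeriv hy) hξ, hA] at h1
  simp only [fderiv_fun_const, Pi.zero_apply, zero_apply] at h1
  have h2 : christoffel G y (ξ y) (ξ y) = -fderiv ℝ ξ y (ξ y) := by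
    have h3 := h.covDeriv_ξ hy
    rw [covDeriv_apply] at h3
    exact eq_neg_of_add_eq_zero_right h3
  have h4 : fderiv ℝ (fderiv ℝ ξ) y (ξ y) u = fderiv ℝ (fderiv ℝ ξ) y u (ξ y) :=
    (h.contDiffAt_ξ hy).isSymmSndFDerivAt (by simp) (ξ y) u
  rw [curvatureCoord_apply, hA, h4, h2]
  simp only [covDeriv_apply, map_add, map_neg] at h1 ⊢
  rw [h.christoffel_symm hy (ξ y) u, h.christoffel_symm hy (christoffel G y u (ξ y)) (ξ y)]
  rw [← sub_eq_zero, ← h1]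
  abel

/-- The Jacobi operator of `ξ` commutes with `φ`. -/
theorem curvature_ξ_ξ_φ (h : IsNormalOn ε₀ ε₁ G φ ξ η U) (hy : y ∈ U) (u : E) :
    curvatureCoord G y (ξ y) (ξ y) (φ y u) = φ y (curvatureCoord G y (ξ y) (ξ y) u) := by
  have hc := differentiableAt_const (𝕜 := ℝ) (x := y) u
  have hA := h.differentiableAt_covDeriv hy
  have hφ := h.differentiableAt_φ hy
  have h1 := congrArg (fun L => L (ξ y)) (fderiv_congr_of_isOpen h.isOpen
    (f := fun z => covDeriv G ξ z (φ z u)) (h := fun z => φ z (covDeriv G ξ z u))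
    (fun z hz => h.covDeriv_φ hz u) hy)
  rw [fderiv_clm_apply_field hA (hφ.clm_apply hc), fderiv_clm_apply_field hφ hc,
    fderiv_clm_apply_field hφ (hA.clm_apply hc), fderiv_clm_apply_field hA hc] at h1
  simp only [fderiv_fun_const, Pi.zero_apply, zero_apply, map_zero, add_zero,
    h.nabla_ξ_φ_eq_zero hy, map_sub, h.covDeriv_φ hy] at h1
  rw [h.curvature_ξ_ξ hy, h.curvature_ξ_ξ hy]
  simp only [map_sub, map_neg, map_add, h.covDeriv_φ hy]
  rw [← sub_eq_zero] at h1 ⊢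
  rw [← neg_eq_zero, ← h1]
  abel

/-- The Ricci tensor of a conformally flat normal almost (para)contact metric structure. -/
theorem ricci_add_ricci_φ (h : IsNormalOn ε₀ ε₁ G φ ξ η U) (hy : y ∈ U)
    {f : E → ℝ} (hf : ContDiffOn ℝ 2 f U)
    (hflat : ∀ u v w, curvatureCoord (fun z => Real.exp (2 * f z) • G z) y v w u = 0) :
    (∀ v w, ricciCoord G y v w = ricciCoord G y w v) ∧
    ∀ v w, η y v = 0 → η y w = 0 →
      ricciCoord G y v w + ε₁ * ricciCoord G y (φ y v) (φ y w) = 0 := by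
  obtain ⟨S, hS, hR⟩ := h.curvature_conformal hf hy
  have hK : ∀ u v w, curvatureCoord G y v w u =
      G y (S v) w • u - G y (S u) w • v + G y v w • S u - G y u w • S v := by
    intro u v w
    have h1 := hR u v w
    rw [hflat] at h1
    rw [← sub_eq_zero, h1]
    abel
  have hric := ricciCoord_eq_of_curvature (h.symm y hy) hS hK
  refine ⟨fun v w => by rw [hric, hric, hS v w, h.symm y hy v w], fun v w hv hw => ?_⟩
  have hJ : ∀ u x, η y u = 0 → η y x = 0 → G y (curvatureCoord G y (ξ y) (ξ y) u) x =
      G y (S (ξ y)) (ξ y) * G y u x + ε₀ * G y (S u) x := by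
    intro u x hu hx
    rw [hK]
    simp only [map_add, map_sub, map_smul, add_apply, sub_apply, smul_apply, smul_eq_mul,
      h.G_ξ hy, h.symm y hy u (ξ y), hu, hx, h.η_ξ y hy]
    ring
  have hvw := h.compat y hy v w
  rw [hv, zero_mul, mul_zero, sub_zero] at hvw
  have h1 := hJ (φ y v) (φ y w) (h.η_φ hy v) (h.η_φ hy w)
  have h2 := hJ v w hv hw
  rw [h.curvature_ξ_ξ_φ hy, h.compat y hy, hw, mul_zero, mul_zero, sub_zero, h2, hvw] at h1
  have h3 : G y (S (φ y v)) (φ y w) = -ε₁ * G y (S v) w :=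
    mul_left_cancel₀ h.ne_zero₀ (by linear_combination -h1)
  rw [hric, hric, h3, hvw]
  linear_combination (-((Module.finrank ℝ E : ℝ) - 2) * G y (S v) w -
    LinearMap.trace ℝ E S * G y v w) * h.sign₁

end IsNormalOn

end Coordinates

section Charts

variable {E : Type*} [NormedAddCommGroup E] [NormedSpace ℝ E]
  {M : Type*} [TopologicalSpace M] [ChartedSpace E M]

/-- The derivative at `y : E` of the inverse of the preferred chart at `x`. -/
def dChartSymm (x : M) (y : E) : E →L[ℝ] E :=
  mfderiv 𝓘(ℝ, E) 𝓘(ℝ, E) (extChartAt 𝓘(ℝ, E) x).symm y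

/-- The derivative of the preferred chart at `x`, at the point with coordinates `y`. -/
def dChart (x : M) (y : E) : E →L[ℝ] E :=
  mfderiv 𝓘(ℝ, E) 𝓘(ℝ, E) (extChartAt 𝓘(ℝ, E) x) ((extChartAt 𝓘(ℝ, E) x).symm y)

/-- Coordinate expression of a vector field in the preferred chart at `x`. -/
def vectorInChart (V : ∀ x : M, TangentSpace 𝓘(ℝ, E) x) (x : M) (y : E) : E :=
  let v : E := V ((extChartAt 𝓘(ℝ, E) x).symm y)
  dChart x y v

/-- Coordinate expression of a `1`-form in the preferred chart at `x`. -/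
def formInChart (η : ∀ x : M, TangentSpace 𝓘(ℝ, E) x →L[ℝ] ℝ) (x : M) (y : E) : E →L[ℝ] ℝ :=
  let a : E →L[ℝ] ℝ := η ((extChartAt 𝓘(ℝ, E) x).symm y)
  a ∘L dChartSymm x y

/-- Coordinate expression of a `(1,1)`-tensor field in the preferred chart at `x`. -/
def endInChart (φ : ∀ x : M, TangentSpace 𝓘(ℝ, E) x →L[ℝ] TangentSpace 𝓘(ℝ, E) x) (x : M) (y : E) :
    E →L[ℝ] E :=
  let P : E →L[ℝ] E := φ ((extChartAt 𝓘(ℝ, E) x).symm y)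
  dChart x y ∘L P ∘L dChartSymm x y

/-- The vector field with constant coordinates `u` in the preferred chart at `x`. -/
def coordField (x : M) (u : E) (p : M) : TangentSpace 𝓘(ℝ, E) p :=
  dChartSymm x (extChartAt 𝓘(ℝ, E) x p) u

theorem mlieBracket_eq_fderiv (V W : E → E) (y : E) :
    (VectorField.mlieBracket 𝓘(ℝ, E) (M := E) V W y : E) =
      fderiv ℝ W y (V y) - fderiv ℝ V y (W y) :=
  ((congrFun VectorField.mlieBracketWithin_univ y).symm.trans
    (congrFun (VectorField.mlieBracketWithin_eq_lieBracketWithin (V := V) (W := W)) y)).trans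
    (congrFun VectorField.lieBracketWithin_univ y)

theorem coordField_chartSymm {x : M} {y : E} (hy : y ∈ (extChartAt 𝓘(ℝ, E) x).target) (u : E) :
    (coordField x u ((extChartAt 𝓘(ℝ, E) x).symm y) : E) = dChartSymm x y u := by
  rw [coordField, (extChartAt 𝓘(ℝ, E) x).right_inv hy]

theorem endInChart_apply
    (φ : ∀ x : M, TangentSpace 𝓘(ℝ, E) x →L[ℝ] TangentSpace 𝓘(ℝ, E) x) {x : M} {y : E}
    (hy : y ∈ (extChartAt 𝓘(ℝ, E) x).target) (u : E) :
    endInChart φ x y u = vectorInChart (fun p => φ p (coordField x u p)) x y := by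
  rw [vectorInChart, coordField_chartSymm hy]
  rfl

theorem formInChart_apply (η : ∀ x : M, TangentSpace 𝓘(ℝ, E) x →L[ℝ] ℝ) {x : M} {y : E}
    (hy : y ∈ (extChartAt 𝓘(ℝ, E) x).target) (u : E) :
    formInChart η x y u = η ((extChartAt 𝓘(ℝ, E) x).symm y)
      (coordField x u ((extChartAt 𝓘(ℝ, E) x).symm y)) := by
  rw [coordField_chartSymm hy]
  rfl

theorem metricInChart_apply
    (g : ∀ x : M, TangentSpace 𝓘(ℝ, E) x →L[ℝ] TangentSpace 𝓘(ℝ, E) x →L[ℝ] ℝ) {x : M} {y : E}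
    (hy : y ∈ (extChartAt 𝓘(ℝ, E) x).target) (u v : E) :
    metricInChart g x y u v = g ((extChartAt 𝓘(ℝ, E) x).symm y)
      (coordField x u ((extChartAt 𝓘(ℝ, E) x).symm y))
      (coordField x v ((extChartAt 𝓘(ℝ, E) x).symm y)) := by
  rw [coordField_chartSymm hy, coordField_chartSymm hy]
  rfl

theorem chartSymm_mem_source {x : M} {y : E} (hy : y ∈ (extChartAt 𝓘(ℝ, E) x).target) :
    (extChartAt 𝓘(ℝ, E) x).symm y ∈ (extChartAt 𝓘(ℝ, E) x).source :=
  (extChartAt 𝓘(ℝ, E) x).map_target hy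

variable [IsManifold 𝓘(ℝ, E) ∞ M]

theorem dChart_dChartSymm {x : M} {y : E} (hy : y ∈ (extChartAt 𝓘(ℝ, E) x).target) (v : E) :
    dChart x y (dChartSymm x y v) = v := by
  have : IsManifold 𝓘(ℝ, E) 1 M := .of_le (n := ∞) (by simp)
  have h := mfderiv_extChartAt_comp_mfderivWithin_extChartAt_symm (I := 𝓘(ℝ, E)) hy
  rw [ModelWithCorners.Boundaryless.range_eq_univ, mfderivWithin_univ] at h
  exact congrArg (fun L : E →L[ℝ] E => L v) h

theorem dChartSymm_dChart {x : M} {y : E} (hy : y ∈ (extChartAt 𝓘(ℝ, E) x).target) (v : E) :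
    dChartSymm x y (dChart x y v) = v := by
  have : IsManifold 𝓘(ℝ, E) 1 M := .of_le (n := ∞) (by simp)
  have h := mfderivWithin_extChartAt_symm_comp_mfderiv_extChartAt (I := 𝓘(ℝ, E)) hy
  rw [ModelWithCorners.Boundaryless.range_eq_univ, mfderivWithin_univ] at h
  exact congrArg (fun L : E →L[ℝ] E => L v) h

theorem dChartSymm_self (x : M) :
    dChartSymm x (extChartAt 𝓘(ℝ, E) x x) = ContinuousLinearMap.id ℝ E := by
  have : IsManifold 𝓘(ℝ, E) 1 M := .of_le (n := ∞) (by simp)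
  have h := mfderivWithin_range_extChartAt_symm (I := 𝓘(ℝ, E)) (x := x)
  rwa [ModelWithCorners.Boundaryless.range_eq_univ, mfderivWithin_univ] at h

theorem dChart_self (x : M) :
    dChart x (extChartAt 𝓘(ℝ, E) x x) = ContinuousLinearMap.id ℝ E := by
  ext v
  have h := dChart_dChartSymm (mem_extChartAt_target (I := 𝓘(ℝ, E)) x) v
  rwa [dChartSymm_self] at h

theorem contMDiffAt_chartSymm {x : M} {y : E} (hy : y ∈ (extChartAt 𝓘(ℝ, E) x).target) :
    ContMDiffAt 𝓘(ℝ, E) 𝓘(ℝ, E) ∞ (extChartAt 𝓘(ℝ, E) x).symm y :=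
  (contMDiffOn_extChartAt_symm x).contMDiffAt ((isOpen_extChartAt_target x).mem_nhds hy)

theorem contDiffAt_vectorInChart {V : ∀ x : M, TangentSpace 𝓘(ℝ, E) x} {x : M} {y : E}
    (hy : y ∈ (extChartAt 𝓘(ℝ, E) x).target)
    (hV : ContMDiffAt 𝓘(ℝ, E) (𝓘(ℝ, E).prod 𝓘(ℝ, E)) ∞
      (fun p => Bundle.TotalSpace.mk' E (E := fun x : M => TangentSpace 𝓘(ℝ, E) x) p (V p))
      ((extChartAt 𝓘(ℝ, E) x).symm y)) :
    ContDiffAt ℝ ∞ (vectorInChart V x) y := by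
  have : IsManifold 𝓘(ℝ, E) 1 M := .of_le (n := ∞) (by simp)
  have hp : (extChartAt 𝓘(ℝ, E) x).symm y ∈ (chartAt E x).source := by
    rw [← extChartAt_source 𝓘(ℝ, E)]
    exact (extChartAt 𝓘(ℝ, E) x).map_target hy
  have h1 := ((trivializationAt E (TangentSpace 𝓘(ℝ, E)) x).contMDiffAt_section_iff
    (by simpa using hp)).1 hV
  have h2 := h1.comp y (contMDiffAt_chartSymm hy)
  refine (h2.congr_of_eventuallyEq ?_).contDiffAt
  filter_upwards [(isOpen_extChartAt_target x).mem_nhds hy] with z hz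
  have hz' : (extChartAt 𝓘(ℝ, E) x).symm z ∈ (chartAt E x).source := by
    rw [← extChartAt_source 𝓘(ℝ, E)]
    exact (extChartAt 𝓘(ℝ, E) x).map_target hz
  have h3 := TangentBundle.continuousLinearMapAt_trivializationAt (I := 𝓘(ℝ, E)) hz'
  have h4 := congrArg (fun L : E →L[ℝ] E => L (V ((extChartAt 𝓘(ℝ, E) x).symm z))) h3
  refine h4.symm.trans ?_
  exact Bundle.Trivialization.continuousLinearMapAt_apply_of_mem ℝ _ (by simpa using hz') _

theorem contMDiffAt_coordField {x p : M} (hp : p ∈ (extChartAt 𝓘(ℝ, E) x).source) (u : E) :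
    ContMDiffAt 𝓘(ℝ, E) (𝓘(ℝ, E).prod 𝓘(ℝ, E)) ∞
      (fun p => Bundle.TotalSpace.mk' E (E := fun x : M => TangentSpace 𝓘(ℝ, E) x) p
        (coordField x u p)) p := by
  have : IsManifold 𝓘(ℝ, E) 1 M := .of_le (n := ∞) (by simp)
  have hp' : p ∈ (chartAt E x).source := by rwa [← extChartAt_source 𝓘(ℝ, E)]
  rw [(trivializationAt E (TangentSpace 𝓘(ℝ, E)) x).contMDiffAt_section_iff (by simpa using hp')]
  refine (contMDiffAt_const (c := u)).congr_of_eventuallyEq ?_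
  filter_upwards [(isOpen_extChartAt_source (I := 𝓘(ℝ, E)) x).mem_nhds hp] with q hq
  have hq' : q ∈ (chartAt E x).source := by rwa [← extChartAt_source 𝓘(ℝ, E)]
  have h3 := TangentBundle.continuousLinearMapAt_trivializationAt (I := 𝓘(ℝ, E)) hq'
  have h4 := congrArg (fun L : E →L[ℝ] E => L (coordField x u q)) h3
  refine (Bundle.Trivialization.continuousLinearMapAt_apply_of_mem ℝ _
    (by simpa using hq') _).symm.trans (h4.trans ?_)
  have h5 := dChart_dChartSymm ((extChartAt 𝓘(ℝ, E) x).map_source hq) u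
  rw [dChart, (extChartAt 𝓘(ℝ, E) x).left_inv hq] at h5
  exact h5

theorem vectorInChart_coordField {x : M} {y : E} (hy : y ∈ (extChartAt 𝓘(ℝ, E) x).target) (u : E) :
    vectorInChart (coordField x u) x y = u := by
  have h := dChart_dChartSymm hy u
  rw [vectorInChart, coordField, (extChartAt 𝓘(ℝ, E) x).right_inv hy]
  exact h

/-- The chart intertwines Lie brackets of vector fields. -/
theorem dChart_mlieBracket [CompleteSpace E] {V W : ∀ x : M, TangentSpace 𝓘(ℝ, E) x} {x : M} {y : E}
    (hy : y ∈ (extChartAt 𝓘(ℝ, E) x).target)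
    (hV : ContMDiffAt 𝓘(ℝ, E) (𝓘(ℝ, E).prod 𝓘(ℝ, E)) ∞
      (fun p => Bundle.TotalSpace.mk' E (E := fun x : M => TangentSpace 𝓘(ℝ, E) x) p (V p))
      ((extChartAt 𝓘(ℝ, E) x).symm y))
    (hW : ContMDiffAt 𝓘(ℝ, E) (𝓘(ℝ, E).prod 𝓘(ℝ, E)) ∞
      (fun p => Bundle.TotalSpace.mk' E (E := fun x : M => TangentSpace 𝓘(ℝ, E) x) p (W p))
      ((extChartAt 𝓘(ℝ, E) x).symm y)) :
    vectorInChart (VectorField.mlieBracket 𝓘(ℝ, E) V W) x y =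
      fderiv ℝ (vectorInChart W x) y (vectorInChart V x y) -
        fderiv ℝ (vectorInChart V x) y (vectorInChart W x y) := by
  have : IsManifold 𝓘(ℝ, E) 1 M := .of_le (n := ∞) (by simp)
  have h2 : minSmoothness ℝ 2 ≤ ∞ := by
    simpa using! (WithTop.coe_le_coe.2 le_top : ((2 : ℕ∞) : WithTop ℕ∞) ≤ ((⊤ : ℕ∞) : WithTop ℕ∞))
  have h3 : minSmoothness ℝ 3 ≤ ∞ := by
    simpa using! (WithTop.coe_le_coe.2 le_top : ((3 : ℕ∞) : WithTop ℕ∞) ≤ ((⊤ : ℕ∞) : WithTop ℕ∞))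
  have : IsManifold 𝓘(ℝ, E) (minSmoothness ℝ 2) M := .of_le h2
  have : IsManifold 𝓘(ℝ, E) (minSmoothness ℝ 3) M := .of_le h3
  have hpull : ∀ (Z : ∀ x : M, TangentSpace 𝓘(ℝ, E) x), ∀ z ∈ (extChartAt 𝓘(ℝ, E) x).target,
      (VectorField.mpullback 𝓘(ℝ, E) 𝓘(ℝ, E) (extChartAt 𝓘(ℝ, E) x).symm Z z : E) =
        vectorInChart Z x z := by
    intro Z z hz
    have h1 : ContinuousLinearMap.inverse (dChartSymm x z) = dChart x z :=
      ContinuousLinearMap.inverse_eq (by ext v; exact dChartSymm_dChart hz v)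
        (by ext v; exact dChart_dChartSymm hz v)
    exact congrArg (fun L : E →L[ℝ] E => L (Z ((extChartAt 𝓘(ℝ, E) x).symm z))) h1
  have hT := (isOpen_extChartAt_target (I := 𝓘(ℝ, E)) x).mem_nhds hy
  have h := VectorField.mpullback_mlieBracket (I := 𝓘(ℝ, E)) (I' := 𝓘(ℝ, E)) (n := ∞)
    (f := (extChartAt 𝓘(ℝ, E) x).symm) (x₀ := y)
    (hV.mdifferentiableAt (by simp)) (hW.mdifferentiableAt (by simp))
    (contMDiffAt_chartSymm hy) h2
  refine ((hpull _ y hy).symm.trans h).trans ((mlieBracket_eq_fderiv _ _ y).trans ?_)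
  have hV' := Filter.eventuallyEq_of_mem hT (hpull V)
  have hW' := Filter.eventuallyEq_of_mem hT (hpull W)
  exact congr_arg₂ (fun a b : E => a - b)
    (congr_arg₂ (fun (L : E →L[ℝ] E) (v : E) => L v) hW'.fderiv_eq (hpull V y hy))
    (congr_arg₂ (fun (L : E →L[ℝ] E) (v : E) => L v) hV'.fderiv_eq (hpull W y hy))

end Charts

theorem two_le_infty : (2 : WithTop ℕ∞) ≤ ∞ := by
  simpa using! (WithTop.coe_le_coe.2 le_top : ((2 : ℕ∞) : WithTop ℕ∞) ≤ ((⊤ : ℕ∞) : WithTop ℕ∞))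

namespace AlmostParaContactMetric

variable {E : Type*} [NormedAddCommGroup E] [NormedSpace ℝ E]
  {M : Type*} [TopologicalSpace M] [ChartedSpace E M] [IsManifold 𝓘(ℝ, E) ∞ M]

theorem contMDiffAt_φ_coordField (S : AlmostParaContactMetric E M) {x : M} {y : E}
    (hy : y ∈ (extChartAt 𝓘(ℝ, E) x).target) (u : E) :
    ContMDiffAt 𝓘(ℝ, E) (𝓘(ℝ, E).prod 𝓘(ℝ, E)) ∞
      (fun p => Bundle.TotalSpace.mk' E (E := fun x : M => TangentSpace 𝓘(ℝ, E) x) p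
        (S.φ p (coordField x u p))) ((extChartAt 𝓘(ℝ, E) x).symm y) :=
  ContMDiffAt.clm_bundle_apply (b := fun p : M => p) (S.smooth_φ _)
    (contMDiffAt_coordField (chartSymm_mem_source hy) u)

theorem contMDiffAt_η_coordField (S : AlmostParaContactMetric E M) {x : M} {y : E}
    (hy : y ∈ (extChartAt 𝓘(ℝ, E) x).target) (u : E) :
    ContMDiffAt 𝓘(ℝ, E) 𝓘(ℝ, ℝ) ∞ (fun p => S.η p (coordField x u p))
      ((extChartAt 𝓘(ℝ, E) x).symm y) := by
  have h := ContMDiffAt.clm_bundle_apply (b := fun p : M => p) (F₂ := ℝ) (E₂ := Bundle.Trivial M ℝ)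
    (S.smooth_η _) (contMDiffAt_coordField (chartSymm_mem_source hy) u)
  rw [Bundle.contMDiffAt_section] at h
  exact h

theorem contMDiffAt_g_coordField (S : AlmostParaContactMetric E M) {x : M} {y : E}
    (hy : y ∈ (extChartAt 𝓘(ℝ, E) x).target) (u v : E) :
    ContMDiffAt 𝓘(ℝ, E) 𝓘(ℝ, ℝ) ∞ (fun p => S.g p (coordField x u p) (coordField x v p))
      ((extChartAt 𝓘(ℝ, E) x).symm y) := by
  have h := ContMDiffAt.clm_bundle_apply₂ (b := fun p : M => p) (F₃ := ℝ)
    (E₃ := Bundle.Trivial M ℝ) (S.smooth_g _)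
    (contMDiffAt_coordField (chartSymm_mem_source hy) u)
    (contMDiffAt_coordField (chartSymm_mem_source hy) v)
  rw [Bundle.contMDiffAt_section] at h
  exact h

theorem contDiffOn_of_contMDiffAt {F : Type*} [NormedAddCommGroup F] [NormedSpace ℝ F] {x : M}
    {f : M → F} {h : E → F}
    (hf : ∀ y ∈ (extChartAt 𝓘(ℝ, E) x).target,
      ContMDiffAt 𝓘(ℝ, E) 𝓘(ℝ, F) ∞ f ((extChartAt 𝓘(ℝ, E) x).symm y))
    (hfh : ∀ y ∈ (extChartAt 𝓘(ℝ, E) x).target, h y = f ((extChartAt 𝓘(ℝ, E) x).symm y)) :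
    ContDiffOn ℝ ∞ h (extChartAt 𝓘(ℝ, E) x).target := fun y hy =>
  ((((hf y hy).comp y (contMDiffAt_chartSymm hy)).contDiffAt).contDiffWithinAt).congr
    (fun z hz => hfh z hz) (hfh y hy)

theorem fderiv_formInChart (S : AlmostParaContactMetric E M) {x : M} {y : E}
    (hy : y ∈ (extChartAt 𝓘(ℝ, E) x).target) (u v : E) :
    fderiv ℝ (fun z => formInChart S.η x z v) y u =
      mvfderiv 𝓘(ℝ, E) (fun p => S.η p (coordField x v p)) ((extChartAt 𝓘(ℝ, E) x).symm y)
        (coordField x u ((extChartAt 𝓘(ℝ, E) x).symm y)) := by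
  have h1 : fderiv ℝ (fun z => formInChart S.η x z v) y =
      fderiv ℝ ((fun p => S.η p (coordField x v p)) ∘ (extChartAt 𝓘(ℝ, E) x).symm) y :=
    fderiv_congr_of_isOpen (isOpen_extChartAt_target x)
      (fun z hz => formInChart_apply S.η hz v) hy
  have h2 := mfderiv_comp y ((S.contMDiffAt_η_coordField hy v).mdifferentiableAt (by simp))
    ((contMDiffAt_chartSymm hy).mdifferentiableAt (by simp))
  rw [mfderiv_eq_fderiv] at h2
  rw [h1, coordField_chartSymm hy]
  exact congrArg (fun L : E →L[ℝ] ℝ => L u) h2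

theorem vectorInChart_φ (S : AlmostParaContactMetric E M) (V : ∀ x : M, TangentSpace 𝓘(ℝ, E) x)
    {x : M} {y : E} (hy : y ∈ (extChartAt 𝓘(ℝ, E) x).target) :
    vectorInChart (fun p => S.φ p (V p)) x y = endInChart S.φ x y (vectorInChart V x y) := by
  have h := dChartSymm_dChart hy (V ((extChartAt 𝓘(ℝ, E) x).symm y))
  let P : E →L[ℝ] E := S.φ ((extChartAt 𝓘(ℝ, E) x).symm y)
  exact congrArg (fun v : E => dChart x y (P v)) h.symm

theorem formInChart_vectorInChart (S : AlmostParaContactMetric E M)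
    (V : ∀ x : M, TangentSpace 𝓘(ℝ, E) x)
    {x : M} {y : E} (hy : y ∈ (extChartAt 𝓘(ℝ, E) x).target) :
    formInChart S.η x y (vectorInChart V x y) = S.η ((extChartAt 𝓘(ℝ, E) x).symm y)
      (V ((extChartAt 𝓘(ℝ, E) x).symm y)) := by
  have h := dChartSymm_dChart hy (V ((extChartAt 𝓘(ℝ, E) x).symm y))
  let a : E →L[ℝ] ℝ := S.η ((extChartAt 𝓘(ℝ, E) x).symm y)
  exact congrArg (fun v : E => a v) h

/-- Normality in the preferred chart at `x`. -/
theorem normal_inChart [FiniteDimensional ℝ E] (S : AlmostParaContactMetric E M)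
    (hS : S.IsNormal) {x : M} {y : E} (hy : y ∈ (extChartAt 𝓘(ℝ, E) x).target)
    (hφ : DifferentiableAt ℝ (endInChart S.φ x) y) (hη : DifferentiableAt ℝ (formInChart S.η x) y)
    (u v : E) :
    fderiv ℝ (endInChart S.φ x) y (endInChart S.φ x y u) v
      - fderiv ℝ (endInChart S.φ x) y (endInChart S.φ x y v) u
      + endInChart S.φ x y (fderiv ℝ (endInChart S.φ x) y v u)
      - endInChart S.φ x y (fderiv ℝ (endInChart S.φ x) y u v) =
    (S.ε₁ * (fderiv ℝ (formInChart S.η x) y u v - fderiv ℝ (formInChart S.η x) y v u)) •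
      vectorInChart S.ξ x y := by
  have : CompleteSpace E := FiniteDimensional.complete ℝ E
  have hT := isOpen_extChartAt_target (I := 𝓘(ℝ, E)) x
  have hc : ∀ c : E, DifferentiableAt ℝ (fun _ : E => c) y := fun c => differentiableAt_const c
  have hX := fun u => contMDiffAt_coordField (chartSymm_mem_source hy) u
  have hφX := S.contMDiffAt_φ_coordField hy
  have dX : ∀ u, fderiv ℝ (vectorInChart (coordField x u) x) y = 0 := fun u => by
    rw [fderiv_congr_of_isOpen hT (h := fun _ => u) (fun z hz => vectorInChart_coordField hz u) hy]
    simp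
  have dφX : ∀ u w, fderiv ℝ (vectorInChart (fun p => S.φ p (coordField x u p)) x) y w =
      fderiv ℝ (endInChart S.φ x) y w u := fun u w => by
    rw [fderiv_congr_of_isOpen hT (h := fun z => endInChart S.φ x z u)
      (fun z hz => (endInChart_apply S.φ hz u).symm) hy, fderiv_clm_apply_field hφ (hc u)]
    simp
  have b1 := dChart_mlieBracket hy (hX u) (hX v)
  have b2 := dChart_mlieBracket hy (hφX u) (hφX v)
  have b3 := dChart_mlieBracket hy (hφX u) (hX v)
  have b4 := dChart_mlieBracket hy (hX u) (hφX v)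
  simp only [dX, dφX, ← endInChart_apply S.φ hy, vectorInChart_coordField hy, zero_apply,
    sub_zero, zero_sub] at b1 b2 b3 b4
  have dη : fderiv ℝ (formInChart S.η x) y u v - fderiv ℝ (formInChart S.η x) y v u =
      2 * S.dη (coordField x u) (coordField x v) ((extChartAt 𝓘(ℝ, E) x).symm y) := by
    have e1 := S.fderiv_formInChart hy u v
    have e2 := S.fderiv_formInChart hy v u
    rw [fderiv_clm_apply_field hη (hc _)] at e1 e2
    simp only [fderiv_fun_const, Pi.zero_apply, zero_apply, map_zero, add_zero] at e1 e2
    have e3 := S.formInChart_vectorInChart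
      (VectorField.mlieBracket 𝓘(ℝ, E) (coordField x u) (coordField x v)) hy
    rw [b1, map_zero] at e3
    simp only [AlmostParaContactMetric.dη]
    rw [e1, e2, ← e3]
    ring
  have h := hS ((extChartAt 𝓘(ℝ, E) x).symm y) (coordField x u) (coordField x v) (hX u) (hX v)
  let p := (extChartAt 𝓘(ℝ, E) x).symm y
  let D : E →L[ℝ] E := dChart x y
  have h' : vectorInChart (fun q => S.nijenhuis (coordField x u) (coordField x v) q) x y -
      (2 * S.ε₁ * S.dη (coordField x u) (coordField x v) p) • vectorInChart S.ξ x y = 0 := by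
    have h1 := congrArg (fun w : E => D w) h
    refine Eq.trans ?_ (h1.trans (map_zero D))
    exact ((map_sub D _ _).trans (congrArg _ (map_smul D _ _))).symm
  have hN : vectorInChart (fun q => S.nijenhuis (coordField x u) (coordField x v) q) x y =
      endInChart S.φ x y (endInChart S.φ x y (vectorInChart
        (VectorField.mlieBracket 𝓘(ℝ, E) (coordField x u) (coordField x v)) x y))
      + vectorInChart (VectorField.mlieBracket 𝓘(ℝ, E) (fun p => S.φ p (coordField x u p))
        (fun p => S.φ p (coordField x v p))) x y
      - endInChart S.φ x y (vectorInChart (VectorField.mlieBracket 𝓘(ℝ, E)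
        (fun p => S.φ p (coordField x u p)) (coordField x v)) x y)
      - endInChart S.φ x y (vectorInChart (VectorField.mlieBracket 𝓘(ℝ, E)
        (coordField x u) (fun p => S.φ p (coordField x v p))) x y) := by
    rw [← S.vectorInChart_φ _ hy, ← S.vectorInChart_φ _ hy, ← S.vectorInChart_φ _ hy,
      ← S.vectorInChart_φ _ hy]
    exact (map_sub D _ _).trans (congrArg (· - _)
      ((map_sub D _ _).trans (congrArg (· - _) (map_add D _ _))))
  rw [hN, b1, b2, b3, b4, sub_eq_zero] at h'
  rw [dη, show S.ε₁ * (2 * S.dη (coordField x u) (coordField x v) p) =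
    2 * S.ε₁ * S.dη (coordField x u) (coordField x v) p by ring, ← h']
  simp only [map_zero, map_neg]
  abel

/-- The coordinate expression of a normal almost (para)contact metric structure. -/
theorem isNormalOn [FiniteDimensional ℝ E] (S : AlmostParaContactMetric E M)
    (hS : S.IsNormal) (x : M) :
    IsNormalOn S.ε₀ S.ε₁ (metricInChart S.g x) (endInChart S.φ x) (vectorInChart S.ξ x)
      (formInChart S.η x) (extChartAt 𝓘(ℝ, E) x).target := by
  have hT := isOpen_extChartAt_target (I := 𝓘(ℝ, E)) x
  have h2 := two_le_infty
  have cφ : ContDiffOn ℝ 2 (endInChart S.φ x) (extChartAt 𝓘(ℝ, E) x).target := by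
    refine ContDiffOn.of_le (contDiffOn_clm_apply.2 fun u z hz => ?_) h2
    exact ((contDiffAt_vectorInChart hz (S.contMDiffAt_φ_coordField hz u)).contDiffWithinAt).congr
      (fun z hz => endInChart_apply S.φ hz u) (endInChart_apply S.φ hz u)
  have cη : ContDiffOn ℝ 2 (formInChart S.η x) (extChartAt 𝓘(ℝ, E) x).target :=
    ContDiffOn.of_le (contDiffOn_clm_apply.2 fun u => contDiffOn_of_contMDiffAt
      (fun y hy => S.contMDiffAt_η_coordField hy u) fun y hy => formInChart_apply S.η hy u) h2
  have cg : ContDiffOn ℝ 2 (metricInChart S.g x) (extChartAt 𝓘(ℝ, E) x).target :=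
    ContDiffOn.of_le (contDiffOn_clm_apply.2 fun u => contDiffOn_clm_apply.2 fun v =>
      contDiffOn_of_contMDiffAt (fun y hy => S.contMDiffAt_g_coordField hy u v)
        fun y hy => metricInChart_apply S.g hy u v) h2
  have cξ : ContDiffOn ℝ 2 (vectorInChart S.ξ x) (extChartAt 𝓘(ℝ, E) x).target := fun z hz =>
    ((contDiffAt_vectorInChart hz (S.smooth_ξ _)).of_le h2).contDiffWithinAt
  refine ⟨⟨hT, cg, fun y _ v w => S.g_symm _ _ _, fun y hy v h => ?_⟩, ?_, ?_, cφ, cξ, cη, ?_, ?_,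
    ?_, fun y hy u v => S.normal_inChart hS hy ((cφ.contDiffAt (hT.mem_nhds hy)).differentiableAt
      (by norm_num)) ((cη.contDiffAt (hT.mem_nhds hy)).differentiableAt (by norm_num)) u v⟩
  · have h1 : dChartSymm x y v = 0 :=
      S.g_nondeg ((extChartAt 𝓘(ℝ, E) x).symm y) (dChartSymm x y v) fun w => by
        have h2 := h (dChart x y w)
        have h3 := dChartSymm_dChart hy w
        let B : E →L[ℝ] E →L[ℝ] ℝ := S.g ((extChartAt 𝓘(ℝ, E) x).symm y)
        exact (congrArg (fun w' : E => B (dChartSymm x y v) w') h3).symm.trans h2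
    rw [← dChart_dChartSymm hy v, h1, map_zero]
  · rcases S.sign₀ with h | h <;> rw [h] <;> norm_num
  · rcases S.sign₁ with h | h <;> rw [h] <;> norm_num
  · intro y hy v
    have h1 : endInChart S.φ x y v = vectorInChart (fun p => S.φ p (coordField x v p)) x y :=
      endInChart_apply S.φ hy v
    rw [h1, ← S.vectorInChart_φ _ hy, formInChart_apply S.η hy]
    let D : E →L[ℝ] E := dChart x y
    refine (congrArg (fun w : E => D w) (S.φ_sq ((extChartAt 𝓘(ℝ, E) x).symm y)
      (coordField x v ((extChartAt 𝓘(ℝ, E) x).symm y)))).trans ?_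
    refine (map_smul D _ _).trans (congrArg _ ((map_sub D _ _).trans ?_))
    exact congr_arg₂ _ (vectorInChart_coordField hy v) (map_smul D _ _)
  · intro y hy
    rw [S.formInChart_vectorInChart _ hy, S.η_ξ]
  · intro y hy v w
    have h3 : ∀ v, dChartSymm x y (endInChart S.φ x y v) =
        S.φ ((extChartAt 𝓘(ℝ, E) x).symm y) (dChartSymm x y v) := fun v =>
      dChartSymm_dChart hy _
    let B : E →L[ℝ] E →L[ℝ] ℝ := S.g ((extChartAt 𝓘(ℝ, E) x).symm y)
    exact (congr_arg₂ (fun a b : E => B a b) (h3 v) (h3 w)).trans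
      (S.compat ((extChartAt 𝓘(ℝ, E) x).symm y) (dChartSymm x y v) (dChartSymm x y w))

end AlmostParaContactMetric

namespace IsNormalOn

variable {E : Type*} [NormedAddCommGroup E] [NormedSpace ℝ E]
  {ε₀ ε₁ : ℝ} {G : E → E →L[ℝ] E →L[ℝ] ℝ} {φ : E → E →L[ℝ] E} {ξ : E → E}
  {η : E → E →L[ℝ] ℝ} {U : Set E} {y : E}

/-- A symmetric bilinear form on the tangent space that is `φ`-anti-invariant (up to sign) on
`Ker η` is determined, up to its `φ`-invariant part, by its contraction with `ξ`. -/
theorem bilin_add_bilin_φ (h : IsNormalOn ε₀ ε₁ G φ ξ η U) (hy : y ∈ U) {r : E →ₗ[ℝ] E →ₗ[ℝ] ℝ}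
    (hr : ∀ v w, r v w = r w v)
    (hker : ∀ v w, η y v = 0 → η y w = 0 → r v w + ε₁ * r (φ y v) (φ y w) = 0) (v w : E) :
    r v w + ε₁ * r (φ y v) (φ y w) =
      η y v * r w (ξ y) + η y w * r v (ξ y) - η y v * η y w * r (ξ y) (ξ y) := by
  have hz : ∀ v, η y (v - η y v • ξ y) = 0 := fun v => by simp [h.η_ξ y hy]
  have h1 := hker _ _ (hz v) (hz w)
  simp only [map_sub, map_smul, h.φ_ξ hy, smul_zero, sub_zero, LinearMap.sub_apply,
    LinearMap.smul_apply, smul_eq_mul] at h1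
  rw [hr (ξ y) w] at h1
  linear_combination h1

/-- The commutator with `φ` of the operator associated with such a form. -/
theorem commutator_φ (h : IsNormalOn ε₀ ε₁ G φ ξ η U) (hy : y ∈ U) {r : E →ₗ[ℝ] E →ₗ[ℝ] ℝ}
    (hr : ∀ v w, r v w = r w v)
    (hker : ∀ v w, η y v = 0 → η y w = 0 → r v w + ε₁ * r (φ y v) (φ y w) = 0)
    {Q : E → E} (hQ : ∀ v w, G y (Q v) w = r v w) (v : E) :
    Q (φ y v) - φ y (Q v) = η y (Q (φ y v)) • ξ y - η y v • φ y (Q (ξ y)) := by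
  have hηQ : ∀ v, ε₀ * η y (Q v) = r v (ξ y) := fun v => by
    rw [← hQ, h.symm y hy, h.G_ξ hy]
  refine h.ext hy fun w => ?_
  have h1 := h.bilin_add_bilin_φ hy hr hker v (φ y w)
  rw [h.η_φ hy, h.φ_sq y hy] at h1
  simp only [map_sub, map_smul, smul_eq_mul] at h1
  rw [← hηQ (φ y v), hr (φ y w)] at h1
  simp only [map_sub, map_smul, sub_apply, smul_apply, smul_eq_mul, h.G_φ hy, hQ, h.G_ξ hy]
  linear_combination h1 - (r (φ y v) w - η y w * (ε₀ * η y (Q (φ y v)))) * h.sign₁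

end IsNormalOn

section Basepoint

variable {E : Type*} [NormedAddCommGroup E] [NormedSpace ℝ E]
  {M : Type*} [TopologicalSpace M] [ChartedSpace E M] [IsManifold 𝓘(ℝ, E) ∞ M]

theorem vectorInChart_self (V : ∀ x : M, TangentSpace 𝓘(ℝ, E) x) (x : M) :
    vectorInChart V x (extChartAt 𝓘(ℝ, E) x x) = V x := by
  let W : M → E := V
  have h : W ((extChartAt 𝓘(ℝ, E) x).symm (extChartAt 𝓘(ℝ, E) x x)) = W x := by
    rw [extChartAt_to_inv]
  exact congr_arg₂ (fun (L : E →L[ℝ] E) v => L v) (dChart_self x) h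

theorem formInChart_self (η : ∀ x : M, TangentSpace 𝓘(ℝ, E) x →L[ℝ] ℝ) (x : M) :
    formInChart η x (extChartAt 𝓘(ℝ, E) x x) = η x := by
  let a : M → E →L[ℝ] ℝ := η
  have h : a ((extChartAt 𝓘(ℝ, E) x).symm (extChartAt 𝓘(ℝ, E) x x)) = a x := by
    rw [extChartAt_to_inv]
  exact congr_arg₂ (fun (L : E →L[ℝ] ℝ) (D : E →L[ℝ] E) => L ∘L D) h (dChartSymm_self x)

theorem endInChart_self
    (φ : ∀ x : M, TangentSpace 𝓘(ℝ, E) x →L[ℝ] TangentSpace 𝓘(ℝ, E) x) (x : M) :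
    endInChart φ x (extChartAt 𝓘(ℝ, E) x x) = φ x := by
  let P : M → E →L[ℝ] E := φ
  have h : P ((extChartAt 𝓘(ℝ, E) x).symm (extChartAt 𝓘(ℝ, E) x x)) = P x := by
    rw [extChartAt_to_inv]
  exact congr_arg₂ (fun (L D : E →L[ℝ] E) => L ∘L D) (dChart_self x)
    (congr_arg₂ (fun (L D : E →L[ℝ] E) => L ∘L D) h (dChartSymm_self x))

theorem metricInChart_self
    (g : ∀ x : M, TangentSpace 𝓘(ℝ, E) x →L[ℝ] TangentSpace 𝓘(ℝ, E) x →L[ℝ] ℝ) (x : M) :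
    metricInChart g x (extChartAt 𝓘(ℝ, E) x x) = g x := by
  let B : M → E →L[ℝ] E →L[ℝ] ℝ := g
  have h : B ((extChartAt 𝓘(ℝ, E) x).symm (extChartAt 𝓘(ℝ, E) x x)) = B x := by
    rw [extChartAt_to_inv]
  exact congr_arg₂ (fun (L : E →L[ℝ] E →L[ℝ] ℝ) (D : E →L[ℝ] E) => L.bilinearComp D D) h
    (dChartSymm_self x)

end Basepoint

namespace AlmostParaContactMetric

variable {E : Type*} [NormedAddCommGroup E] [NormedSpace ℝ E] [FiniteDimensional ℝ E]
  {M : Type*} [TopologicalSpace M] [ChartedSpace E M] [IsManifold 𝓘(ℝ, E) ∞ M]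

/-- The Ricci tensor of a conformally flat normal structure, in the preferred chart at `x`. -/
theorem ricciCoord_inChart (S : AlmostParaContactMetric E M) (hnormal : S.IsNormal)
    (hflat : IsConformallyFlat S.g) (x : M) :
    (∀ v w, ricciCoord (metricInChart S.g x) (extChartAt 𝓘(ℝ, E) x x) v w =
      ricciCoord (metricInChart S.g x) (extChartAt 𝓘(ℝ, E) x x) w v) ∧
    ∀ v w, formInChart S.η x (extChartAt 𝓘(ℝ, E) x x) v = 0 →
      formInChart S.η x (extChartAt 𝓘(ℝ, E) x x) w = 0 →
      ricciCoord (metricInChart S.g x) (extChartAt 𝓘(ℝ, E) x x) v w +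
        S.ε₁ * ricciCoord (metricInChart S.g x) (extChartAt 𝓘(ℝ, E) x x)
          (endInChart S.φ x (extChartAt 𝓘(ℝ, E) x x) v)
          (endInChart S.φ x (extChartAt 𝓘(ℝ, E) x x) w) = 0 := by
  obtain ⟨U, hU, hxU, f, hf, hcurv⟩ := hflat x
  have hV : IsOpen ((extChartAt 𝓘(ℝ, E) x).target ∩ (extChartAt 𝓘(ℝ, E) x).symm ⁻¹' U) :=
    (continuousOn_extChartAt_symm x).isOpen_inter_preimage (isOpen_extChartAt_target x) hU
  have hx : extChartAt 𝓘(ℝ, E) x x ∈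
      (extChartAt 𝓘(ℝ, E) x).target ∩ (extChartAt 𝓘(ℝ, E) x).symm ⁻¹' U :=
    ⟨mem_extChartAt_target x, by rwa [mem_preimage, extChartAt_to_inv]⟩
  have hf' : ContDiffOn ℝ 2 (fun z => f ((extChartAt 𝓘(ℝ, E) x).symm z))
      ((extChartAt 𝓘(ℝ, E) x).target ∩ (extChartAt 𝓘(ℝ, E) x).symm ⁻¹' U) := fun z hz =>
    ((((hf.contMDiffAt (hU.mem_nhds hz.2)).comp z
      (contMDiffAt_chartSymm hz.1)).contDiffAt).of_le two_le_infty).contDiffWithinAt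
  exact ((S.isNormalOn hnormal x).mono hV inter_subset_left).ricci_add_ricci_φ hx hf'
    fun u v w => hcurv x hxU u v w

theorem ricci_add_ricci_φ (S : AlmostParaContactMetric E M) (hnormal : S.IsNormal)
    (hflat : IsConformallyFlat S.g) (x : M) (X Y : TangentSpace 𝓘(ℝ, E) x) :
    ricci S.g x X Y + S.ε₁ * ricci S.g x (S.φ x X) (S.φ x Y) =
      S.η x X * ricci S.g x Y (S.ξ x) + S.η x Y * ricci S.g x X (S.ξ x)
        - S.η x X * S.η x Y * ricci S.g x (S.ξ x) (S.ξ x) := by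
  obtain ⟨hr, hker⟩ := S.ricciCoord_inChart hnormal hflat x
  have h := (S.isNormalOn hnormal x).bilin_add_bilin_φ (mem_extChartAt_target x) hr hker X Y
  rw [endInChart_self, formInChart_self, vectorInChart_self] at h
  exact h

theorem ricciOp_commutator_φ (S : AlmostParaContactMetric E M) (hnormal : S.IsNormal)
    (hflat : IsConformallyFlat S.g) (x : M) (X : TangentSpace 𝓘(ℝ, E) x) :
    ricciOp S.g x (S.φ x X) - S.φ x (ricciOp S.g x X) =
      S.η x (ricciOp S.g x (S.φ x X)) • S.ξ x - S.η x X • S.φ x (ricciOp S.g x (S.ξ x)) := by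
  obtain ⟨hr, hker⟩ := S.ricciCoord_inChart hnormal hflat x
  have hS := S.isNormalOn hnormal x
  have hQ : ∀ v w : E, metricInChart S.g x (extChartAt 𝓘(ℝ, E) x x) (ricciOp S.g x v) w =
      ricciCoord (metricInChart S.g x) (extChartAt 𝓘(ℝ, E) x x) v w := by
    intro v w
    have h1 := hS.apply_inverse (mem_extChartAt_target x) (LinearMap.toContinuousLinearMap
      (ricciCoord (metricInChart S.g x) (extChartAt 𝓘(ℝ, E) x x) v)) w
    rw [metricInChart_self] at h1 ⊢
    exact h1
  have h := hS.commutator_φ (mem_extChartAt_target x) hr hker (Q := ricciOp S.g x) hQ X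
  rw [endInChart_self, formInChart_self, vectorInChart_self] at h
  exact h

end AlmostParaContactMetric

end ParaContact

end
theorem mainTheorem10 {E : Type*} [NormedAddCommGroup E] [NormedSpace ℝ E]
    [FiniteDimensional ℝ E] {M : Type*} [TopologicalSpace M] [ChartedSpace E M]
    [IsManifold 𝓘(ℝ, E) ∞ M] (n : ℕ) (hdim : Module.finrank ℝ E = 2 * n + 1)
    (hn : 5 ≤ 2 * n + 1) (S : ParaContact.AlmostParaContactMetric E M)
    (hnormal : S.IsNormal) (hflat : ParaContact.IsConformallyFlat S.g) :
    (∀ (x : M) (X : TangentSpace 𝓘(ℝ, E) x),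
      ParaContact.ricciOp S.g x (S.φ x X) - S.φ x (ParaContact.ricciOp S.g x X) =
        S.η x (ParaContact.ricciOp S.g x (S.φ x X)) • S.ξ x
          - S.η x X • S.φ x (ParaContact.ricciOp S.g x (S.ξ x))) ∧
    (∀ (x : M) (X Y : TangentSpace 𝓘(ℝ, E) x),
      ParaContact.ricci S.g x X Y + S.ε₁ * ParaContact.ricci S.g x (S.φ x X) (S.φ x Y) =
        S.η x X * ParaContact.ricci S.g x Y (S.ξ x) + S.η x Y * ParaContact.ricci S.g x X (S.ξ x)
          - S.η x X * S.η x Y * ParaContact.ricci S.g x (S.ξ x) (S.ξ x)) ∧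
    (∀ (x : M) (X : TangentSpace 𝓘(ℝ, E) x), S.η x X = 0 →
      ParaContact.ricci S.g x X X + S.ε₁ * ParaContact.ricci S.g x (S.φ x X) (S.φ x X) = 0) := by
  refine ⟨S.ricciOp_commutator_φ hnormal hflat, S.ricci_add_ricci_φ hnormal hflat, fun x X hX => ?_⟩
  rw [S.ricci_add_ricci_φ hnormal hflat, hX]
  ring
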